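/- Let $X$ be a Dedekind complete complex Banach lattice, that is, the complexification $X = E \oplus iE$ of a Dedekind complete real Banach lattice $E$, with modulus $|x+iy| = \sup_{\theta\in\mathbb{R}} \big((\cos\theta)x + (\sin\theta)y\big)$ and norm $\|z\| = \|\,|z|\,\|$. Let $S$ be a $d$-isomorphism of $X$, i.e. a bounded invertible linear operator on $X$ such that $|x_1|\wedge|x_2| = 0$ implies $|Sx_1|\wedge|Sx_2| = 0$ for all $x_1,x_2\in X$. Let $A$ belong to the center $Z(X)$ of $X$, i.e. $A$ is a linear operator on $X$ for which there is $c\ge 0$ with $|Ax|\le c|x|$ for all $x\in X$. Put $T = AS$. Let $Y$ be a closed (complex) linear subspace of $X$ that is approximating in modulus (AIM), i.e. for every $x\in X$ and every $\varepsilon>0$ there is $y\in Y$ with $\|\,|x|-|y|\,\|\le\varepsilon$, and suppose that $TY\subseteq Y$. Then $$\sigma_{ap}(T,X) = \sigma_{ap}(T,Y).$$ Here, for a Banach space $V$ and a bounded linear operator $T$ that maps $V$ into itself, $\sigma(T,V)$ is the spectrum of $T$ as an operator on $V$, $\sigma_r(T,V) = \{\lambda\in\sigma(T,V) : \exists\,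 c>0\ \ \forall x\in V\ \ \|\lambda x - Tx\|\ge c\|x\|\}$, and $\sigma_{ap}(T,V) = \sigma(T,V)\setminus\sigma_r(T,V)$. -/

import Mathlib

noncomputable section

/-- The complexification `E ⊕ iE` of a real vector space `E`; `⟨x, y⟩` stands for `x + iy`. -/
@[ext]
structure Cpx (E : Type*) where
  re : E
  im : E

namespace Cpx

section Algebra

variable {E : Type*} [AddCommGroup E]

instance : Zero (Cpx E) := ⟨⟨0, 0⟩⟩
instance : Add (Cpx E) := ⟨fun z w => ⟨z.re + w.re, z.im + w.im⟩⟩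
instance : Neg (Cpx E) := ⟨fun z => ⟨-z.re, -z.im⟩⟩

@[simp] theorem zero_re : (0 : Cpx E).re = 0 := rfl
@[simp] theorem zero_im : (0 : Cpx E).im = 0 := rfl
@[simp] theorem add_re (z w : Cpx E) : (z + w).re = z.re + w.re := rfl
@[simp] theorem add_im (z w : Cpx E) : (z + w).im = z.im + w.im := rfl
@[simp] theorem neg_re (z : Cpx E) : (-z).re = -z.re := rfl
@[simp] theorem neg_im (z : Cpx E) : (-z).im = -z.im := rfl

instance : AddCommGroup (Cpx E) where
  add_assoc z w u := by ext <;> simp [add_assoc]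
  zero_add z := by ext <;> simp
  add_zero z := by ext <;> simp
  neg_add_cancel z := by ext <;> simp
  add_comm z w := by ext <;> simp [add_comm]
  nsmul := nsmulRec
  zsmul := zsmulRec

variable [Module ℝ E]

/-- `(a + ib)(x + iy) = (ax - by) + i(ay + bx)`. -/
instance : SMul ℂ (Cpx E) :=
  ⟨fun c z => ⟨c.re • z.re - c.im • z.im, c.re • z.im + c.im • z.re⟩⟩

@[simp] theorem smul_re (c : ℂ) (z : Cpx E) : (c • z).re = c.re • z.re - c.im • z.im := rfl
@[simp] theorem smul_im (c : ℂ) (z : Cpx E) : (c • z).im = c.re • z.im + c.im • z.re := rfl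

instance : Module ℂ (Cpx E) where
  one_smul z := by ext <;> simp
  mul_smul c d z := by
    ext
    · simp only [smul_re, smul_im, Complex.mul_re, Complex.mul_im]; module
    · simp only [smul_re, smul_im, Complex.mul_re, Complex.mul_im]; module
  smul_zero c := by ext <;> simp
  smul_add c z w := by
    ext
    · simp only [smul_re, add_re, add_im]; module
    · simp only [smul_im, add_re, add_im]; module
  add_smul c d z := by
    ext
    · simp only [smul_re, add_re, Complex.add_re, Complex.add_im]; module
    · simp only [smul_im, add_im, Complex.add_re, Complex.add_im]; module
  zero_smul z := by ext <;> simp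

end Algebra

section Modulus

variable {E : Type*} [NormedAddCommGroup E] [ConditionallyCompleteLattice E]
  [IsOrderedAddMonoid E] [NormedSpace ℝ E] [IsOrderedModule ℝ E]

/-- The modulus `|x + iy| = sup {(cos θ) x + (sin θ) y : θ ∈ ℝ}`. The supremum is taken of a
nonempty set that is bounded above, so it is a genuine one. -/
def modulus (z : Cpx E) : E := ⨆ θ : ℝ, (Real.cos θ • z.re + Real.sin θ • z.im)


theorem bddAbove_modulus (z : Cpx E) :
    BddAbove (Set.range fun θ : ℝ => Real.cos θ • z.re + Real.sin θ • z.im) := by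
  have key : ∀ (t : ℝ) (x : E), |t| ≤ 1 → t • x ≤ |x| := by
    intro t x ht
    have h1 : t • x ≤ |t| • |x| := by
      rcases le_total 0 t with h | h
      · rw [abs_of_nonneg h]
        exact smul_le_smul_of_nonneg_left (le_abs_self x) h
      · rw [abs_of_nonpos h, ← neg_smul_neg]
        exact smul_le_smul_of_nonneg_left (neg_le_abs x) (neg_nonneg.mpr h)
    calc t • x ≤ |t| • |x| := h1
      _ ≤ (1 : ℝ) • |x| := smul_le_smul_of_nonneg_right ht (abs_nonneg x)
      _ = |x| := one_smul _ _
  refine ⟨|z.re| + |z.im|, ?_⟩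
  rintro _ ⟨θ, rfl⟩
  exact add_le_add (key _ _ (Real.abs_cos_le_one θ)) (key _ _ (Real.abs_sin_le_one θ))

theorem le_modulus (z : Cpx E) (θ : ℝ) :
    Real.cos θ • z.re + Real.sin θ • z.im ≤ modulus z :=
  le_ciSup (bddAbove_modulus z) θ

theorem neg_le_modulus (z : Cpx E) (θ : ℝ) :
    -(Real.cos θ • z.re + Real.sin θ • z.im) ≤ modulus z := by
  have h := le_modulus z (θ + Real.pi)
  rw [Real.cos_add_pi, Real.sin_add_pi] at h
  have e : -(Real.cos θ • z.re + Real.sin θ • z.im)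
      = -Real.cos θ • z.re + -Real.sin θ • z.im := by module
  rwa [e]

theorem abs_le_modulus (z : Cpx E) (θ : ℝ) :
    |Real.cos θ • z.re + Real.sin θ • z.im| ≤ modulus z :=
  abs_le'.mpr ⟨le_modulus z θ, neg_le_modulus z θ⟩

theorem modulus_nonneg (z : Cpx E) : 0 ≤ modulus z :=
  (abs_nonneg _).trans (abs_le_modulus z 0)

theorem abs_re_le_modulus (z : Cpx E) : |z.re| ≤ modulus z := by
  simpa using abs_le_modulus z 0

theorem abs_im_le_modulus (z : Cpx E) : |z.im| ≤ modulus z := by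
  simpa using abs_le_modulus z (Real.pi / 2)

theorem modulus_add_le (z w : Cpx E) : modulus (z + w) ≤ modulus z + modulus w := by
  refine ciSup_le fun θ => ?_
  have e : Real.cos θ • (z + w).re + Real.sin θ • (z + w).im
      = (Real.cos θ • z.re + Real.sin θ • z.im) + (Real.cos θ • w.re + Real.sin θ • w.im) := by
    simp only [add_re, add_im]; module
  rw [e]
  exact add_le_add (le_modulus z θ) (le_modulus w θ)

theorem modulus_smul_le (c : ℂ) (z : Cpx E) : modulus (c • z) ≤ ‖c‖ • modulus z := by
  refine ciSup_le fun θ => ?_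
  have e : Real.cos θ • (c • z).re + Real.sin θ • (c • z).im
      = ‖c‖ • (Real.cos (θ - c.arg) • z.re + Real.sin (θ - c.arg) • z.im) := by
    rw [Real.cos_sub, Real.sin_sub, smul_re, smul_im, ← Complex.norm_mul_cos_arg c,
      ← Complex.norm_mul_sin_arg c]
    module
  rw [e]
  exact smul_le_smul_of_nonneg_left (le_modulus z _) (norm_nonneg c)

/-- The norm of the complexification: `‖z‖ = ‖|z|‖`. -/
instance : Norm (Cpx E) := ⟨fun z => ‖modulus z‖⟩

variable [HasSolidNorm E]

theorem norm_mono {F : Type*} [NormedAddCommGroup F] [Lattice F] [IsOrderedAddMonoid F]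
    [HasSolidNorm F] {a b : F} (ha : 0 ≤ a) (hab : a ≤ b) : ‖a‖ ≤ ‖b‖ :=
  norm_le_norm_of_abs_le_abs (by rwa [abs_of_nonneg ha, abs_of_nonneg (ha.trans hab)])

theorem norm_smul_le' (c : ℂ) (z : Cpx E) : ‖c • z‖ ≤ ‖c‖ * ‖z‖ := by
  have h := norm_mono (modulus_nonneg (c • z)) (modulus_smul_le c z)
  rwa [norm_smul, norm_norm] at h

theorem normedSpaceCore : NormedSpace.Core ℂ (Cpx E) where
  norm_nonneg z := norm_nonneg (modulus z)
  norm_smul c z := by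
    refine le_antisymm (norm_smul_le' c z) ?_
    rcases eq_or_ne c 0 with rfl | hc
    · rw [norm_zero, zero_mul]
      exact norm_nonneg (modulus ((0 : ℂ) • z))
    · have h := norm_smul_le' c⁻¹ (c • z)
      rw [inv_smul_smul₀ hc, norm_inv] at h
      calc ‖c‖ * ‖z‖ ≤ ‖c‖ * (‖c‖⁻¹ * ‖c • z‖) := mul_le_mul_of_nonneg_left h (norm_nonneg c)
        _ = ‖c • z‖ := mul_inv_cancel_left₀ (norm_ne_zero_iff.mpr hc) _
  norm_triangle z w :=
    (norm_mono (modulus_nonneg _) (modulus_add_le z w)).trans (norm_add_le _ _)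
  norm_eq_zero_iff z := by
    constructor
    · intro h
      have h0 : modulus z = 0 := norm_eq_zero.mp h
      have hr := abs_re_le_modulus z
      have hi := abs_im_le_modulus z
      rw [h0] at hr hi
      ext
      · exact le_antisymm ((le_abs_self _).trans hr) (neg_nonpos.mp ((neg_le_abs _).trans hr))
      · exact le_antisymm ((le_abs_self _).trans hi) (neg_nonpos.mp ((neg_le_abs _).trans hi))
    · rintro rfl
      have h0 : modulus (0 : Cpx E) = 0 := by simp [modulus]
      exact norm_eq_zero.mpr h0

instance : NormedAddCommGroup (Cpx E) := NormedAddCommGroup.ofCore normedSpaceCore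

instance : NormedSpace ℂ (Cpx E) := NormedSpace.ofCore normedSpaceCore

/-- `T` preserves disjointness: `|x| ∧ |y| = 0` implies `|Tx| ∧ |Ty| = 0`. -/
def DisjointnessPreserving (T : Cpx E →L[ℂ] Cpx E) : Prop :=
  ∀ x y : Cpx E, modulus x ⊓ modulus y = 0 → modulus (T x) ⊓ modulus (T y) = 0

/-- A `d`-isomorphism: a bounded, invertible, disjointness preserving linear operator. -/
structure IsDIsomorphism (S : Cpx E →L[ℂ] Cpx E) : Prop where
  bijective : Function.Bijective S
  disjointnessPreserving : DisjointnessPreserving S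

/-- `A` belongs to the (ideal) center: `|A| ≤ c I`, that is `|Ax| ≤ c |x|` for all `x`, for some
real `c ≥ 0`. -/
def IsCentral (A : Cpx E →L[ℂ] Cpx E) : Prop :=
  ∃ c : ℝ, 0 ≤ c ∧ ∀ x : Cpx E, modulus (A x) ≤ c • modulus x

/-- A closed subspace `Y` that is approximating in modulus. -/
structure IsAIM (Y : Submodule ℂ (Cpx E)) : Prop where
  isClosed : IsClosed (Y : Set (Cpx E))
  approx : ∀ (x : Cpx E) (ε : ℝ), 0 < ε → ∃ y ∈ Y, ‖modulus x - modulus y‖ ≤ ε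

end Modulus

end Cpx

section Spectrum

variable {V : Type*} [NormedAddCommGroup V] [NormedSpace ℂ V]

/-- The points `lam` of the spectrum of `T` such that `lam - T` is bounded from below. -/
def residualSpectrum (T : V →L[ℂ] V) : Set ℂ :=
  {lam | lam ∈ spectrum ℂ T ∧ ∃ c : ℝ, 0 < c ∧ ∀ x : V, c * ‖x‖ ≤ ‖lam • x - T x‖}

/-- The approximate point spectrum. -/
def approxPointSpectrum (T : V →L[ℂ] V) : Set ℂ :=
  spectrum ℂ T \ residualSpectrum T

end Spectrum

end

set_option linter.unusedSectionVars false

/-! ### Disjointness and band projections in a Dedekind complete Riesz space. -/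

namespace Riesz

section Lattice

variable {E : Type*} [AddCommGroup E] [Lattice E] [IsOrderedAddMonoid E]

/-! A point `lam` lies in the approximate point spectrum exactly when `lam - T` is not bounded from
below, so the content is that a lower bound on `Y` yields one on `X`. The basic tool is that a
bounded disjointness preserving `D` satisfies `|Dx| = |D|x||`, so that `‖Dx‖` is a Lipschitz
function of `|x|`. Such norms therefore pass from an AIM subspace to the whole space, which settles
`lam = 0`; for `lam ≠ 0`, scaling reduces to `lam = 1`.

The operator `T - 1` does not preserve disjointness, but suitable polynomials in `T` do on suitable
bands. If a set `V` is disjoint from its first `k` images under `S`, any polynomial in `T` of degree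
at most `k` preserves disjointness on the band generated by `V`. Applying the bound on `Y` to `W₂
y`, with `(T - 1) W₂ = W₁`, gives `c ‖W₂ u‖ ≤ ‖W₁ u‖` for `y ∈ Y` in place of `u`, and hence for `u`
in that band (`IsAIM.lower_bound_of_disjointnessPreserving`).

There are two choices of `W₂`, as in Rokhlin's lemma. Away from the small periods, `W₂` has the
coefficients of a tall hat of slope `1 / N`. Then `W₁` has coefficients of size at most `1 / N`, and
for large `N` the resulting term is absorbed (`norm_window_le`, `exists_lower_bound_aperiodic`). On
the part of exact period `p`, `W₂ = 1 + T + ⋯ + T^(p-1)` and `W₁ = T^p - 1`; the latter preserves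
disjointness there because `S^p` moves no band (`exists_lower_bound_periodic`). A maximal wandering
set supplies finitely many bands covering the part in question. `exists_lower_bound_of_one` glues
the parts, whose band projections commute with `T`. -/

theorem add_inf_le_add {a b c : E} (ha : 0 ≤ a) (hb : 0 ≤ b) (hc : 0 ≤ c) :
    (a + b) ⊓ c ≤ a ⊓ c + b ⊓ c := by
  rw [add_inf, inf_add, inf_add]
  refine le_inf (le_inf inf_le_left ?_) (le_inf ?_ ?_)
  · exact inf_le_right.trans (le_add_of_nonneg_right hb)
  · exact inf_le_right.trans (le_add_of_nonneg_left ha)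
  · exact inf_le_right.trans (le_add_of_nonneg_left hc)

theorem inf_eq_zero_of_le {a b c d : E} (ha : 0 ≤ a) (hb : 0 ≤ b) (hac : a ≤ c) (hbd : b ≤ d)
    (h : c ⊓ d = 0) : a ⊓ b = 0 :=
  le_antisymm ((inf_le_inf hac hbd).trans h.le) (le_inf ha hb)

theorem add_inf_eq_zero {a b c : E} (ha : 0 ≤ a) (hb : 0 ≤ b) (hac : a ⊓ c = 0)
    (hbc : b ⊓ c = 0) : (a + b) ⊓ c = 0 := by
  have hc : 0 ≤ c := hac ▸ inf_le_right
  refine le_antisymm ((add_inf_le_add ha hb hc).trans ?_) (le_inf (add_nonneg ha hb) hc)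
  rw [hac, hbc, add_zero]

theorem add_le_of_inf_eq_zero {a b c : E} (h : a ⊓ b = 0) (hac : a ≤ c) (hbc : b ≤ c) :
    a + b ≤ c := by
  rw [← inf_add_sup, h, zero_add]
  exact sup_le hac hbc

theorem le_of_le_add_of_inf_eq_zero {a b c : E} (ha : 0 ≤ a) (hb : 0 ≤ b) (hc : 0 ≤ c)
    (h : a ⊓ c = 0) (hle : a ≤ b + c) : a ≤ b := by
  have h1 : a ≤ (b + c) ⊓ a := le_inf hle le_rfl
  have h2 := h1.trans (add_inf_le_add hb hc ha)
  rw [inf_comm c a, h, add_zero] at h2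
  exact h2.trans inf_le_left

variable [Module ℝ E] [IsOrderedModule ℝ E]

theorem smul_inf_eq_zero {a b : E} {r : ℝ} (hr : 0 ≤ r) (h : a ⊓ b = 0) : (r • a) ⊓ b = 0 := by
  have ha : 0 ≤ a := h ▸ inf_le_left
  have hb : 0 ≤ b := h ▸ inf_le_right
  -- With `s ≥ r` and `s ≥ 1`, the element `s⁻¹ • ((r • a) ⊓ b)` lies below both `a` and `b`.
  set s : ℝ := max r 1
  have hs : 0 < s := lt_of_lt_of_le one_pos (le_max_right r 1)
  have h0 : 0 ≤ (r • a) ⊓ b := le_inf (smul_nonneg hr ha) hb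
  refine le_antisymm ?_ h0
  have h1 : s⁻¹ • ((r • a) ⊓ b) ≤ 0 := by
    rw [← h]
    refine le_inf ?_ ?_
    · calc s⁻¹ • ((r • a) ⊓ b) ≤ s⁻¹ • (s • a) :=
            smul_le_smul_of_nonneg_left
              (inf_le_left.trans (smul_le_smul_of_nonneg_right (le_max_left r 1) ha))
              (inv_nonneg.2 hs.le)
        _ = a := inv_smul_smul₀ hs.ne' a
    · calc s⁻¹ • ((r • a) ⊓ b) ≤ (1 : ℝ) • ((r • a) ⊓ b) :=
            smul_le_smul_of_nonneg_right (inv_le_one_of_one_le₀ (le_max_right r 1)) h0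
        _ ≤ b := by rw [one_smul]; exact inf_le_right
  calc (r • a) ⊓ b = s • (s⁻¹ • ((r • a) ⊓ b)) := (smul_inv_smul₀ hs.ne' _).symm
    _ ≤ s • (0 : E) := smul_le_smul_of_nonneg_left h1 hs.le
    _ = 0 := smul_zero s

theorem abs_smul_le (r : ℝ) (x : E) : |r • x| ≤ |r| • |x| := by
  rcases le_total 0 r with h | h
  · rw [abs_of_nonneg h]
    refine abs_le'.2 ⟨smul_le_smul_of_nonneg_left (le_abs_self x) h, ?_⟩
    rw [← smul_neg]
    exact smul_le_smul_of_nonneg_left (neg_le_abs x) h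
  · rw [abs_of_nonpos h]
    have h' := neg_nonneg.2 h
    refine abs_le'.2 ⟨?_, ?_⟩
    · rw [← neg_smul_neg]
      exact smul_le_smul_of_nonneg_left (neg_le_abs x) h'
    · rw [← neg_smul]
      exact smul_le_smul_of_nonneg_left (le_abs_self x) h'

/-- The disjoint complement of a subset of a Riesz space. -/
def polar (V : Set E) : Submodule ℝ E where
  carrier := {x | ∀ v ∈ V, |x| ⊓ |v| = 0}
  zero_mem' v _ := by rw [abs_zero]; exact inf_eq_left.2 (abs_nonneg v)
  add_mem' {a b} ha hb v hv := inf_eq_zero_of_le (abs_nonneg _) (abs_nonneg _) (abs_add_le a b)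
    le_rfl (add_inf_eq_zero (abs_nonneg a) (abs_nonneg b) (ha v hv) (hb v hv))
  smul_mem' r a ha v hv := inf_eq_zero_of_le (abs_nonneg _) (abs_nonneg _) (abs_smul_le r a)
    le_rfl (smul_inf_eq_zero (abs_nonneg r) (ha v hv))

theorem mem_polar_of_abs_le {V : Set E} {x y : E} (hy : y ∈ polar V) (h : |x| ≤ |y|) :
    x ∈ polar V := fun v hv =>
  inf_eq_zero_of_le (abs_nonneg _) (abs_nonneg _) h le_rfl (hy v hv)

theorem disjoint_polar (V : Set E) : Disjoint (polar (polar V : Set E)) (polar V) := by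
  rw [Submodule.disjoint_def]
  intro x hx hx'
  have h := hx x hx'
  rw [inf_idem] at h
  exact le_antisymm ((le_abs_self x).trans h.le) (neg_nonpos.1 ((neg_le_abs x).trans h.le))

end Lattice

section Projection

variable {E : Type*} [AddCommGroup E] [ConditionallyCompleteLattice E] [IsOrderedAddMonoid E]
  [Module ℝ E] [IsOrderedModule ℝ E]

/-- Riesz decomposition: the component in `polar V` is the supremum of the elements of `polar V`
between `0` and `x`. This is where Dedekind completeness enters. -/
theorem exists_add_of_nonneg (V : Set E) {x : E} (hx : 0 ≤ x) :
    ∃ y ∈ polar V, x - y ∈ polar (polar V : Set E) := by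
  set s : Set E := {v | 0 ≤ v ∧ v ≤ x ∧ v ∈ polar V} with hs
  have hbdd : BddAbove s := ⟨x, fun v hv => hv.2.1⟩
  have h0 : (0 : E) ∈ s := ⟨le_rfl, hx, zero_mem _⟩
  have hy0 : 0 ≤ sSup s := le_csSup hbdd h0
  have hyx : sSup s ≤ x := csSup_le ⟨0, h0⟩ fun v hv => hv.2.1
  have hyV : sSup s ∈ polar V := by
    intro v hv
    rw [abs_of_nonneg hy0]
    set w := sSup s ⊓ |v|
    have hw0 : 0 ≤ w := le_inf hy0 (abs_nonneg v)
    refine le_antisymm ?_ hw0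
    -- Each `u ∈ s` is disjoint from `w`, and both lie below `sSup s`, so `u + w` does too. Hence
    -- `w` can be subtracted from the supremum.
    have h1 : sSup s ≤ sSup s - w := by
      refine csSup_le ⟨0, h0⟩ fun u hu => ?_
      refine le_sub_iff_add_le.2 (add_le_of_inf_eq_zero ?_ (le_csSup hbdd hu) inf_le_left)
      refine inf_eq_zero_of_le hu.1 hw0 (le_abs_self u) inf_le_right (hu.2.2 v hv)
    simpa using h1
  refine ⟨sSup s, hyV, fun w hw => ?_⟩
  have hxy : 0 ≤ x - sSup s := sub_nonneg.2 hyx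
  rw [abs_of_nonneg hxy]
  set v := (x - sSup s) ⊓ |w|
  have hv0 : 0 ≤ v := le_inf hxy (abs_nonneg w)
  refine le_antisymm ?_ hv0
  have hvV : v ∈ polar V := mem_polar_of_abs_le hw (by rw [abs_of_nonneg hv0]; exact inf_le_right)
  -- If the remainder had a nonzero part `v` in `polar V`, then `sSup s + v` would be a larger
  -- member of `s`.
  have h1 : sSup s + v ≤ sSup s := by
    refine le_csSup hbdd ⟨add_nonneg hy0 hv0, ?_, add_mem hyV hvV⟩
    rw [add_comm]
    exact le_sub_iff_add_le.1 inf_le_left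
  simpa using h1

theorem exists_add (V : Set E) (x : E) :
    ∃ y ∈ polar V, x - y ∈ polar (polar V : Set E) := by
  obtain ⟨y, hy, hy'⟩ := exists_add_of_nonneg V (posPart_nonneg x)
  obtain ⟨z, hz, hz'⟩ := exists_add_of_nonneg V (negPart_nonneg x)
  refine ⟨y - z, sub_mem hy hz, ?_⟩
  have e : x - (y - z) = (x⁺ - y) - (x⁻ - z) := by
    conv_lhs => rw [← posPart_sub_negPart x]
    abel
  rw [e]
  exact sub_mem hy' hz'

theorem isCompl_polar (V : Set E) : IsCompl (polar (polar V : Set E)) (polar V) :=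
  ⟨disjoint_polar V, by
    rw [codisjoint_iff, Submodule.eq_top_iff']
    intro x
    obtain ⟨y, hy, hy'⟩ := exists_add V x
    exact Submodule.mem_sup.2 ⟨x - y, hy', y, hy, sub_add_cancel x y⟩⟩

end Projection

end Riesz

namespace Riesz

variable {E : Type*} [AddCommGroup E] [ConditionallyCompleteLattice E] [IsOrderedAddMonoid E]
  [Module ℝ E] [IsOrderedModule ℝ E]

/-- The projection of a Dedekind complete Riesz space onto the band generated by `V`. -/
noncomputable def bandProj (V : Set E) : E →ₗ[ℝ] E :=
  (polar (polar V : Set E)).projection (polar V) (isCompl_polar V)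

theorem bandProj_mem (V : Set E) (x : E) : bandProj V x ∈ polar (polar V : Set E) :=
  Submodule.projection_apply_mem _ x

theorem sub_bandProj_mem (V : Set E) (x : E) : x - bandProj V x ∈ polar V := by
  rw [← Submodule.projection_apply_eq_zero_iff (isCompl_polar V), map_sub, sub_eq_zero]
  exact (Submodule.projection_apply_of_mem_left _ (bandProj_mem V x)).symm

theorem bandProj_of_mem {V : Set E} {x : E} (hx : x ∈ polar (polar V : Set E)) :
    bandProj V x = x := Submodule.projection_apply_of_mem_left _ hx

theorem bandProj_of_mem_polar {V : Set E} {x : E} (hx : x ∈ polar V) :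
    bandProj V x = 0 := Submodule.projection_apply_of_mem_right _ hx

theorem abs_add_of_inf_eq_zero {a b : E} (h : |a| ⊓ |b| = 0) : |a + b| = |a| + |b| := by
  refine le_antisymm (abs_add_le a b) (add_le_of_inf_eq_zero h ?_ ?_)
  · refine le_of_le_add_of_inf_eq_zero (abs_nonneg _) (abs_nonneg _) (abs_nonneg b) h ?_
    simpa using abs_add_le (a + b) (-b)
  · refine le_of_le_add_of_inf_eq_zero (abs_nonneg _) (abs_nonneg _) (abs_nonneg a)
      (by rwa [inf_comm]) ?_
    simpa using abs_add_le (a + b) (-a)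

theorem bandProj_nonneg_and_le (V : Set E) {x : E} (hx : 0 ≤ x) :
    0 ≤ bandProj V x ∧ bandProj V x ≤ x := by
  have h1 := abs_add_of_inf_eq_zero (bandProj_mem V x _ (sub_bandProj_mem V x))
  rw [add_sub_cancel, abs_of_nonneg hx] at h1
  have ha := le_abs_self (bandProj V x)
  have hb := le_abs_self (x - bandProj V x)
  have h2 : |x - bandProj V x| ≤ x - bandProj V x := by
    have h3 : |bandProj V x| = x - |x - bandProj V x| := by rw [eq_sub_iff_add_eq]; exact h1.symm
    rw [h3] at ha
    exact le_sub_comm.1 ha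
  have h4 : |bandProj V x| ≤ bandProj V x := by
    have h3 : |x - bandProj V x| = x - |bandProj V x| := by rw [eq_sub_iff_add_eq']; exact h1.symm
    rw [h3] at hb
    exact (sub_le_sub_iff_left x).1 hb
  exact ⟨(abs_nonneg _).trans h4, sub_nonneg.1 ((abs_nonneg _).trans h2)⟩

theorem bandProj_mono (V : Set E) {x y : E} (h : x ≤ y) : bandProj V x ≤ bandProj V y := by
  rw [← sub_nonneg, ← map_sub]
  exact (bandProj_nonneg_and_le V (sub_nonneg.2 h)).1

theorem sub_bandProj_mono (V : Set E) {x y : E} (h : x ≤ y) :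
    x - bandProj V x ≤ y - bandProj V y := by
  have h1 := (bandProj_nonneg_and_le V (sub_nonneg.2 h)).2
  rw [map_sub] at h1
  rw [← sub_nonneg] at h1 ⊢
  convert h1 using 1
  abel

/-- Lets a band projection separate the region where `v ≥ 0` from the region where `v ≤ 0`; the
bisection of step elements rests on it. -/
theorem bandProj_posPart_self (v : E) : bandProj {v⁺} v = v⁺ := by
  have h1 : v⁺ ∈ polar (polar {v⁺} : Set E) := fun w hw => by
    rw [inf_comm]; exact hw _ rfl
  have h2 : v⁻ ∈ polar {v⁺} := by
    rintro _ rfl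
    rw [abs_of_nonneg (posPart_nonneg v), abs_of_nonneg (negPart_nonneg v), inf_comm]
    exact posPart_inf_negPart_eq_zero v
  calc bandProj {v⁺} v = bandProj {v⁺} (v⁺ - v⁻) := by rw [posPart_sub_negPart]
    _ = v⁺ := by rw [map_sub, bandProj_of_mem h1, bandProj_of_mem_polar h2, sub_zero]

end Riesz

/-! ### Modulus, disjointness and band projections in the complexification. -/

namespace Cpx

variable {E : Type*} [NormedAddCommGroup E] [ConditionallyCompleteLattice E]
  [IsOrderedAddMonoid E] [NormedSpace ℝ E] [IsOrderedModule ℝ E]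

theorem modulus_le (z : Cpx E) : modulus z ≤ |z.re| + |z.im| := by
  have key : ∀ (t : ℝ) (x : E), |t| ≤ 1 → t • x ≤ |x| := fun t x ht =>
    (le_abs_self _).trans ((Riesz.abs_smul_le t x).trans
      ((smul_le_smul_of_nonneg_right ht (abs_nonneg x)).trans_eq (one_smul ℝ _)))
  exact ciSup_le fun θ => add_le_add (key _ _ (Real.abs_cos_le_one θ))
    (key _ _ (Real.abs_sin_le_one θ))

theorem modulus_smul (c : ℂ) (z : Cpx E) : modulus (c • z) = ‖c‖ • modulus z := by
  refine le_antisymm (modulus_smul_le c z) ?_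
  rcases eq_or_ne c 0 with rfl | hc
  · rw [norm_zero, zero_smul]; exact modulus_nonneg _
  · have h := modulus_smul_le c⁻¹ (c • z)
    rw [inv_smul_smul₀ hc, norm_inv] at h
    calc ‖c‖ • modulus z ≤ ‖c‖ • ‖c‖⁻¹ • modulus (c • z) :=
          smul_le_smul_of_nonneg_left h (norm_nonneg c)
      _ = modulus (c • z) := smul_inv_smul₀ (norm_ne_zero_iff.2 hc) _

theorem modulus_zero : modulus (0 : Cpx E) = 0 := by simp [modulus]

theorem eq_zero_of_modulus_eq_zero {z : Cpx E} (h : modulus z = 0) : z = 0 := by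
  have hr := abs_re_le_modulus z
  have hi := abs_im_le_modulus z
  rw [h] at hr hi
  ext
  · exact le_antisymm ((le_abs_self _).trans hr) (neg_nonpos.mp ((neg_le_abs _).trans hr))
  · exact le_antisymm ((le_abs_self _).trans hi) (neg_nonpos.mp ((neg_le_abs _).trans hi))

theorem modulus_neg (z : Cpx E) : modulus (-z) = modulus z := by
  have h := modulus_smul (-1) z
  simpa using h

theorem modulus_sub_le (z w : Cpx E) : modulus (z - w) ≤ modulus z + modulus w := by
  rw [sub_eq_add_neg, ← modulus_neg w]
  exact modulus_add_le z (-w)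

theorem abs_modulus_sub_modulus_le (z w : Cpx E) :
    |modulus z - modulus w| ≤ modulus (z - w) := by
  rw [abs_le', neg_sub, sub_le_iff_le_add, sub_le_iff_le_add]
  constructor
  · simpa using modulus_add_le (z - w) w
  · simpa [add_comm] using modulus_sub_le z (z - w)

/-- Two elements are disjoint if the infimum of their moduli vanishes. -/
def Disj (z w : Cpx E) : Prop := modulus z ⊓ modulus w = 0

theorem Disj.symm {z w : Cpx E} (h : Disj z w) : Disj w z := by
  rwa [Disj, inf_comm]

theorem Disj.mono {z w z' w' : Cpx E} (h : Disj z w) (hz : modulus z' ≤ modulus z)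
    (hw : modulus w' ≤ modulus w) : Disj z' w' :=
  Riesz.inf_eq_zero_of_le (modulus_nonneg _) (modulus_nonneg _) hz hw h

theorem Disj.mono_smul {z w z' : Cpx E} (h : Disj z w) {r : ℝ} (hr : 0 ≤ r)
    (hz : modulus z' ≤ r • modulus z) : Disj z' w :=
  Riesz.inf_eq_zero_of_le (modulus_nonneg _) (modulus_nonneg _) hz le_rfl
    (Riesz.smul_inf_eq_zero hr h)

theorem Disj.modulus_add {z w : Cpx E} (h : Disj z w) :
    modulus (z + w) = modulus z + modulus w := by
  refine le_antisymm (modulus_add_le z w) (Riesz.add_le_of_inf_eq_zero h ?_ ?_)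
  · refine Riesz.le_of_le_add_of_inf_eq_zero (modulus_nonneg _) (modulus_nonneg _)
      (modulus_nonneg w) h ?_
    simpa using modulus_sub_le (z + w) w
  · refine Riesz.le_of_le_add_of_inf_eq_zero (modulus_nonneg _) (modulus_nonneg _)
      (modulus_nonneg z) h.symm ?_
    simpa using modulus_sub_le (z + w) z

theorem Disj.eq_zero {z : Cpx E} (h : Disj z z) : z = 0 :=
  eq_zero_of_modulus_eq_zero (by rwa [Disj, inf_idem] at h)

/-- The disjoint complement. -/
def polar (V : Set (Cpx E)) : Submodule ℂ (Cpx E) where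
  carrier := {z | ∀ v ∈ V, Disj z v}
  zero_mem' v _ := by rw [Disj, modulus_zero]; exact inf_eq_left.2 (modulus_nonneg v)
  add_mem' {a b} ha hb v hv := Riesz.inf_eq_zero_of_le (modulus_nonneg _) (modulus_nonneg _)
    (modulus_add_le a b) le_rfl
    (Riesz.add_inf_eq_zero (modulus_nonneg a) (modulus_nonneg b) (ha v hv) (hb v hv))
  smul_mem' c a ha v hv := (ha v hv).mono_smul (norm_nonneg c) (modulus_smul_le c a)

theorem mem_polar {V : Set (Cpx E)} {z : Cpx E} : z ∈ polar V ↔ ∀ v ∈ V, Disj z v := Iff.rfl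

theorem mem_polar_of_modulus_le {V : Set (Cpx E)} {z w : Cpx E} (hw : w ∈ polar V)
    (h : modulus z ≤ modulus w) : z ∈ polar V := fun v hv => (hw v hv).mono h le_rfl

theorem mem_polar_of_re_im {V : Set (Cpx E)} {z : Cpx E}
    (hr : z.re ∈ Riesz.polar (modulus '' V)) (hi : z.im ∈ Riesz.polar (modulus '' V)) :
    z ∈ polar V := by
  intro v hv
  have h1 := hr _ ⟨v, hv, rfl⟩
  have h2 := hi _ ⟨v, hv, rfl⟩
  rw [abs_of_nonneg (modulus_nonneg v)] at h1 h2
  exact Riesz.inf_eq_zero_of_le (modulus_nonneg _) (modulus_nonneg _) (modulus_le z) le_rfl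
    (Riesz.add_inf_eq_zero (abs_nonneg _) (abs_nonneg _) h1 h2)

theorem modulus_mem_polar {V : Set (Cpx E)} {z : Cpx E} (hz : z ∈ polar V) :
    modulus z ∈ Riesz.polar (modulus '' V) := by
  rintro _ ⟨v, hv, rfl⟩
  rw [abs_of_nonneg (modulus_nonneg v), abs_of_nonneg (modulus_nonneg z)]
  exact hz v hv

theorem mem_polar_polar_of_re_im {V : Set (Cpx E)} {z : Cpx E}
    (hr : z.re ∈ Riesz.polar (Riesz.polar (modulus '' V) : Set E))
    (hi : z.im ∈ Riesz.polar (Riesz.polar (modulus '' V) : Set E)) :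
    z ∈ polar (polar V : Set (Cpx E)) := by
  refine mem_polar_of_re_im (fun _ hw => hr _ ?_) (fun _ hw => hi _ ?_) <;>
  · obtain ⟨u, hu, rfl⟩ := hw
    exact modulus_mem_polar hu

theorem subset_polar_polar {V : Set (Cpx E)} {v : Cpx E} (hv : v ∈ V) :
    v ∈ polar (polar V : Set (Cpx E)) := fun _ hw => (hw v hv).symm

/-- The band projection onto the band generated by `V`, acting on real and imaginary parts. -/
noncomputable def bandProjLin (V : Set (Cpx E)) : Cpx E →ₗ[ℂ] Cpx E where
  toFun z := ⟨Riesz.bandProj (modulus '' V) z.re, Riesz.bandProj (modulus '' V) z.im⟩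
  map_add' z w := by ext <;> simp
  map_smul' c z := by ext <;> simp

theorem bandProjLin_mem (V : Set (Cpx E)) (z : Cpx E) :
    bandProjLin V z ∈ polar (polar V : Set (Cpx E)) :=
  mem_polar_polar_of_re_im (Riesz.bandProj_mem _ _) (Riesz.bandProj_mem _ _)

theorem sub_re (z w : Cpx E) : (z - w).re = z.re - w.re := by
  rw [sub_eq_add_neg, add_re, neg_re, sub_eq_add_neg]

theorem sub_im (z w : Cpx E) : (z - w).im = z.im - w.im := by
  rw [sub_eq_add_neg, add_im, neg_im, sub_eq_add_neg]

theorem sub_bandProjLin_mem (V : Set (Cpx E)) (z : Cpx E) :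
    z - bandProjLin V z ∈ polar V := by
  refine mem_polar_of_re_im ?_ ?_
  · rw [sub_re]; exact Riesz.sub_bandProj_mem _ _
  · rw [sub_im]; exact Riesz.sub_bandProj_mem _ _

theorem modulus_eq_bandProjLin_add (V : Set (Cpx E)) (z : Cpx E) :
    modulus z = modulus (bandProjLin V z) + modulus (z - bandProjLin V z) := by
  rw [← Disj.modulus_add (bandProjLin_mem V z _ (sub_bandProjLin_mem V z)), add_sub_cancel]

variable [HasSolidNorm E]

theorem norm_def (z : Cpx E) : ‖z‖ = ‖modulus z‖ := rfl

theorem norm_le_of_modulus_le {z w : Cpx E} (h : modulus z ≤ modulus w) : ‖z‖ ≤ ‖w‖ :=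
  norm_mono (F := E) (modulus_nonneg z) h

/-- The band projection onto the band generated by `V`. -/
noncomputable def bandProj (V : Set (Cpx E)) : Cpx E →L[ℂ] Cpx E :=
  (bandProjLin V).mkContinuous 1 fun z => by
    rw [one_mul]
    refine norm_le_of_modulus_le ?_
    rw [modulus_eq_bandProjLin_add V z]
    exact le_add_of_nonneg_right (modulus_nonneg _)

theorem bandProj_im (V : Set (Cpx E)) (z : Cpx E) :
    (bandProj V z).im = Riesz.bandProj (modulus '' V) z.im := rfl

theorem bandProj_mem (V : Set (Cpx E)) (z : Cpx E) :
    bandProj V z ∈ polar (polar V : Set (Cpx E)) := bandProjLin_mem V z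

theorem sub_bandProj_mem (V : Set (Cpx E)) (z : Cpx E) : z - bandProj V z ∈ polar V :=
  sub_bandProjLin_mem V z

theorem modulus_eq_bandProj_add (V : Set (Cpx E)) (z : Cpx E) :
    modulus z = modulus (bandProj V z) + modulus (z - bandProj V z) :=
  modulus_eq_bandProjLin_add V z

theorem modulus_bandProj_le (V : Set (Cpx E)) (z : Cpx E) :
    modulus (bandProj V z) ≤ modulus z := by
  rw [modulus_eq_bandProj_add V z]
  exact le_add_of_nonneg_right (modulus_nonneg _)

theorem modulus_sub_bandProj_le (V : Set (Cpx E)) (z : Cpx E) :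
    modulus (z - bandProj V z) ≤ modulus z := by
  rw [modulus_eq_bandProj_add V z]
  exact le_add_of_nonneg_left (modulus_nonneg _)

theorem bandProj_eq {V : Set (Cpx E)} {z w : Cpx E} (hw : w ∈ polar (polar V : Set (Cpx E)))
    (hzw : z - w ∈ polar V) : bandProj V z = w := by
  have h1 : bandProj V z - w ∈ polar (polar V : Set (Cpx E)) := sub_mem (bandProj_mem V z) hw
  have h2 : bandProj V z - w ∈ polar V := by
    have := sub_mem hzw (sub_bandProj_mem V z)
    rwa [sub_sub_sub_cancel_left] at this
  exact sub_eq_zero.1 (h1 _ h2).eq_zero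

theorem bandProj_of_mem {V : Set (Cpx E)} {z : Cpx E} (hz : z ∈ polar (polar V : Set (Cpx E))) :
    bandProj V z = z := bandProj_eq hz (by rw [sub_self]; exact zero_mem _)

/-- The embedding of `E` into its complexification. -/
def ofReal (f : E) : Cpx E := ⟨f, 0⟩

theorem modulus_ofReal (f : E) : modulus (ofReal f) = |f| := by
  refine le_antisymm ?_ (abs_re_le_modulus (ofReal f))
  have h := modulus_le (ofReal f)
  simpa [ofReal] using h

theorem modulus_ofReal_of_nonneg {f : E} (hf : 0 ≤ f) : modulus (ofReal f) = f := by
  rw [modulus_ofReal, abs_of_nonneg hf]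

theorem ofReal_add (f g : E) : ofReal (f + g) = ofReal f + ofReal g := by
  ext <;> simp [ofReal]

theorem ofReal_sub (f g : E) : ofReal (f - g) = ofReal f - ofReal g := by
  ext <;> simp [ofReal, sub_re, sub_im]

theorem ofReal_smul (r : ℝ) (f : E) : ofReal (r • f) = (r : ℂ) • ofReal f := by
  ext
  · rw [smul_re]; simp [ofReal]
  · rw [smul_im]; simp [ofReal]

theorem norm_ofReal (f : E) : ‖ofReal f‖ = ‖f‖ := by
  rw [norm_def, modulus_ofReal, norm_abs_eq_norm]

theorem bandProj_ofReal (V : Set (Cpx E)) (f : E) :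
    bandProj V (ofReal f) = ofReal (Riesz.bandProj (modulus '' V) f) := by
  ext
  · rfl
  · rw [bandProj_im]; simp [ofReal]

theorem norm_modulus_sub_le (z w : Cpx E) : ‖modulus z - modulus w‖ ≤ ‖z - w‖ :=
  norm_le_norm_of_abs_le_abs (by
    rw [abs_of_nonneg (modulus_nonneg (z - w))]; exact abs_modulus_sub_modulus_le z w)

theorem exists_bandProj_sign (v : E) : ∃ V : Set (Cpx E),
    0 ≤ Riesz.bandProj (modulus '' V) v ∧ v - Riesz.bandProj (modulus '' V) v ≤ 0 := by
  refine ⟨{ofReal v⁺}, ?_⟩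
  rw [Set.image_singleton, modulus_ofReal_of_nonneg (posPart_nonneg v),
    Riesz.bandProj_posPart_self]
  exact ⟨posPart_nonneg v, sub_nonpos.2 (le_posPart v)⟩

end Cpx

/-! ### Step approximation, and how disjointness preserving operators act on moduli. -/

namespace Cpx

variable {E : Type*} [NormedAddCommGroup E] [ConditionallyCompleteLattice E]
  [IsOrderedAddMonoid E] [NormedSpace ℝ E] [IsOrderedModule ℝ E] [HasSolidNorm E]

/-- `s` behaves under `D` like a linear combination of pairwise disjoint components of `e`. -/
structure StepLike (D : Cpx E →L[ℂ] Cpx E) (s : Cpx E) (e : E) : Prop where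
  modulus_map : modulus (D s) = modulus (D (ofReal (modulus s)))
  bounded : ∃ C : ℝ, 0 ≤ C ∧ modulus s ≤ C • e
  dominated : ∀ c : ℝ, 0 ≤ c → modulus s ≤ c • e → modulus (D s) ≤ c • modulus (D (ofReal e))

theorem stepLike_smul (D : Cpx E →L[ℂ] Cpx E) (c : ℂ) {e : E} (he : 0 ≤ e) :
    StepLike D (c • ofReal e) e where
  modulus_map := by
    rw [modulus_smul, modulus_ofReal_of_nonneg he, ofReal_smul, map_smul, map_smul, modulus_smul,
      modulus_smul, Complex.norm_real, norm_norm]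
  bounded := ⟨‖c‖, norm_nonneg c, by rw [modulus_smul, modulus_ofReal_of_nonneg he]⟩
  dominated r hr h := by
    rw [modulus_smul, modulus_ofReal_of_nonneg he] at h
    rw [map_smul, modulus_smul]
    rcases le_or_gt ‖c‖ r with hc | hc
    · exact smul_le_smul_of_nonneg_right hc (modulus_nonneg _)
    · have h1 : (‖c‖ - r) • e ≤ 0 := by rw [sub_smul]; exact sub_nonpos.2 h
      have h2 : e ≤ 0 := by
        have h3 := smul_le_smul_of_nonneg_left h1 (inv_nonneg.2 (sub_pos.2 hc).le)
        rwa [inv_smul_smul₀ (sub_pos.2 hc).ne', smul_zero] at h3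
      have h4 : e = 0 := le_antisymm h2 he
      have h5 : ofReal (0 : E) = 0 := rfl
      rw [h4, h5, map_zero, modulus_zero, smul_zero, smul_zero]

/-- Disjointness of `e` and `f` forces that of `s` and `t`, and `D` keeps both. All moduli then add,
and a bound on `s + t` by a multiple of `e + f` splits into one for each summand. -/
theorem StepLike.add {D : Cpx E →L[ℂ] Cpx E} (hD : DisjointnessPreserving D) {s t : Cpx E}
    {e f : E} (he : 0 ≤ e) (hf : 0 ≤ f) (hef : Disj (ofReal e) (ofReal f)) (hs : StepLike D s e)
    (ht : StepLike D t f) : StepLike D (s + t) (e + f) := by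
  obtain ⟨C, hC, hsC⟩ := hs.bounded
  obtain ⟨K, hK, htK⟩ := ht.bounded
  have hsf : Disj s (ofReal f) :=
    hef.mono_smul hC (by rwa [modulus_ofReal_of_nonneg he])
  have hst : Disj s t :=
    (hsf.symm.mono_smul hK (by rwa [modulus_ofReal_of_nonneg hf])).symm
  have hte : Disj t (ofReal e) :=
    hef.symm.mono_smul hK (by rwa [modulus_ofReal_of_nonneg hf])
  have hmod := hst.modulus_add
  have hDst : Disj (D s) (D t) := hD s t hst
  refine ⟨?_, ⟨C + K, add_nonneg hC hK, ?_⟩, ?_⟩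
  · have h1 : Disj (ofReal (modulus s)) (ofReal (modulus t)) := hst.mono
      (modulus_ofReal_of_nonneg (modulus_nonneg s)).le
      (modulus_ofReal_of_nonneg (modulus_nonneg t)).le
    have h2 : Disj (D (ofReal (modulus s))) (D (ofReal (modulus t))) := hD _ _ h1
    rw [hmod, ofReal_add, map_add, map_add, hDst.modulus_add, h2.modulus_add, hs.modulus_map,
      ht.modulus_map]
  · rw [hmod, add_smul, smul_add, smul_add]
    exact add_le_add (hsC.trans (le_add_of_nonneg_right (smul_nonneg hC hf)))
      (htK.trans (le_add_of_nonneg_left (smul_nonneg hK he)))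
  · intro c hc h
    rw [hmod, smul_add] at h
    have hs' : modulus s ≤ c • e := by
      refine Riesz.le_of_le_add_of_inf_eq_zero (modulus_nonneg s) (smul_nonneg hc he)
        (smul_nonneg hc hf) ?_ ((le_add_of_nonneg_right (modulus_nonneg t)).trans h)
      rw [inf_comm]
      refine Riesz.smul_inf_eq_zero hc ?_
      have := hsf.symm
      rwa [Disj, modulus_ofReal_of_nonneg hf] at this
    have ht' : modulus t ≤ c • f := by
      refine Riesz.le_of_le_add_of_inf_eq_zero (modulus_nonneg t) (smul_nonneg hc hf)
        (smul_nonneg hc he) ?_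
        ((le_add_of_nonneg_left (modulus_nonneg s)).trans (h.trans_eq (add_comm _ _)))
      rw [inf_comm]
      refine Riesz.smul_inf_eq_zero hc ?_
      have := hte.symm
      rwa [Disj, modulus_ofReal_of_nonneg he] at this
    have h2 : Disj (D (ofReal e)) (D (ofReal f)) := hD _ _ hef
    rw [ofReal_add, map_add, map_add, hDst.modulus_add, h2.modulus_add, smul_add]
    exact add_le_add (hs.dominated c hc hs') (ht.dominated c hc ht')

theorem exists_stepLike_of_bandProj {D : Cpx E →L[ℂ] Cpx E} (hD : DisjointnessPreserving D)
    (V : Set (Cpx E)) {x : Cpx E} {e : E} (he : 0 ≤ e) {δ : ℝ}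
    (h₁ : ∃ s, StepLike D s (Riesz.bandProj (modulus '' V) e) ∧
      modulus (bandProj V x - s) ≤ δ • Riesz.bandProj (modulus '' V) e)
    (h₂ : ∃ s, StepLike D s (e - Riesz.bandProj (modulus '' V) e) ∧
      modulus (x - bandProj V x - s) ≤ δ • (e - Riesz.bandProj (modulus '' V) e)) :
    ∃ s, StepLike D s e ∧ modulus (x - s) ≤ δ • e := by
  obtain ⟨s, hs, hs'⟩ := h₁
  obtain ⟨t, ht, ht'⟩ := h₂
  have hp := Riesz.bandProj_nonneg_and_le (modulus '' V) he
  have hdisj : Disj (ofReal (Riesz.bandProj (modulus '' V) e))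
      (ofReal (e - Riesz.bandProj (modulus '' V) e)) := by
    have h := bandProj_mem V (ofReal e) _ (sub_bandProj_mem V (ofReal e))
    rwa [bandProj_ofReal, ← ofReal_sub] at h
  refine ⟨s + t, ?_, ?_⟩
  · have h := hs.add hD hp.1 (sub_nonneg.2 hp.2) hdisj ht
    rwa [add_sub_cancel] at h
  · have e1 : x - (s + t) = (bandProj V x - s) + (x - bandProj V x - t) := by abel
    rw [e1]
    refine (modulus_add_le _ _).trans ((add_le_add hs' ht').trans_eq ?_)
    rw [← smul_add, add_sub_cancel]

/-- A Freudenthal type approximation by quartering. If `x` takes values, relative to `e`, in a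
square of side `h`, then band projections split `e` into four components on which the square has
side `h / 2`. After `n` rounds a constant on each component is within `2 * h / 2 ^ n`; the factor
`2` comes from `|z| ≤ |re z| + |im z|`. -/
theorem exists_stepLike_of_mem_square {D : Cpx E →L[ℂ] Cpx E} (hD : DisjointnessPreserving D)
    (n : ℕ) : ∀ (x : Cpx E) (e : E) (α β h : ℝ), 0 ≤ e → 0 ≤ h →
      α • e ≤ x.re → x.re ≤ (α + h) • e → β • e ≤ x.im → x.im ≤ (β + h) • e →
      ∃ s, StepLike D s e ∧ modulus (x - s) ≤ (2 * h / 2 ^ n) • e := by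
  have key : ∀ (V : Set (Cpx E)) (γ : ℝ) (e f : E),
      0 ≤ Riesz.bandProj (modulus '' V) (f - γ • e) →
      γ • Riesz.bandProj (modulus '' V) e ≤ Riesz.bandProj (modulus '' V) f := by
    intro V γ e f h
    rwa [map_sub, map_smul, sub_nonneg] at h
  have key' : ∀ (V : Set (Cpx E)) (γ : ℝ) (e f : E),
      (f - γ • e) - Riesz.bandProj (modulus '' V) (f - γ • e) ≤ 0 →
      f - Riesz.bandProj (modulus '' V) f ≤ γ • (e - Riesz.bandProj (modulus '' V) e) := by
    intro V γ e f h
    rw [map_sub, map_smul] at h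
    rw [← sub_nonpos]
    convert h using 1
    module
  have mono : ∀ (V : Set (Cpx E)) (γ : ℝ) (e f : E), γ • e ≤ f →
      γ • Riesz.bandProj (modulus '' V) e ≤ Riesz.bandProj (modulus '' V) f := by
    intro V γ e f h
    rw [← map_smul]
    exact Riesz.bandProj_mono _ h
  have mono' : ∀ (V : Set (Cpx E)) (γ : ℝ) (e f : E), f ≤ γ • e →
      Riesz.bandProj (modulus '' V) f ≤ γ • Riesz.bandProj (modulus '' V) e := by
    intro V γ e f h
    rw [← map_smul]
    exact Riesz.bandProj_mono _ h
  have smono : ∀ (V : Set (Cpx E)) (γ : ℝ) (e f : E), γ • e ≤ f →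
      γ • (e - Riesz.bandProj (modulus '' V) e) ≤ f - Riesz.bandProj (modulus '' V) f := by
    intro V γ e f h
    rw [smul_sub, ← map_smul]
    exact Riesz.sub_bandProj_mono _ h
  have smono' : ∀ (V : Set (Cpx E)) (γ : ℝ) (e f : E), f ≤ γ • e →
      f - Riesz.bandProj (modulus '' V) f ≤ γ • (e - Riesz.bandProj (modulus '' V) e) := by
    intro V γ e f h
    rw [smul_sub, ← map_smul]
    exact Riesz.sub_bandProj_mono _ h
  induction n with
  | zero =>
    intro x e α β h he hh h1 h2 h3 h4
    refine ⟨(⟨α, β⟩ : ℂ) • ofReal e, stepLike_smul D _ he, (modulus_le _).trans ?_⟩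
    have e1 : (x - (⟨α, β⟩ : ℂ) • ofReal e).re = x.re - α • e := by
      rw [sub_re, smul_re]; simp [ofReal]
    have e2 : (x - (⟨α, β⟩ : ℂ) • ofReal e).im = x.im - β • e := by
      rw [sub_im, smul_im]; simp [ofReal]
    rw [add_smul] at h2 h4
    rw [e1, e2, abs_of_nonneg (sub_nonneg.2 h1), abs_of_nonneg (sub_nonneg.2 h3), pow_zero,
      div_one, two_mul, add_smul]
    exact add_le_add (sub_le_iff_le_add'.2 h2) (sub_le_iff_le_add'.2 h4)
  | succ n ih =>
    intro x e α β h he hh h1 h2 h3 h4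
    have hδ : 2 * h / 2 ^ (n + 1) = 2 * (h / 2) / 2 ^ n := by field_simp; ring
    have hh' : 0 ≤ h / 2 := by positivity
    rw [hδ]
    -- Bisects the imaginary part only, once the real part already lies in an interval of length `h
    -- / 2`. It is used on both halves of the real bisection.
    have half : ∀ (x : Cpx E) (e : E) (α β : ℝ), 0 ≤ e →
      α • e ≤ x.re → x.re ≤ (α + h / 2) • e → β • e ≤ x.im → x.im ≤ (β + h) • e →
      ∃ s, StepLike D s e ∧ modulus (x - s) ≤ (2 * (h / 2) / 2 ^ n) • e := by
      intro x e α β he h1 h2 h3 h4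
      obtain ⟨V, hV, hV'⟩ := exists_bandProj_sign (x.im - (β + h / 2) • e)
      have hp := Riesz.bandProj_nonneg_and_le (modulus '' V) he
      refine exists_stepLike_of_bandProj hD V he
        (ih _ _ α (β + h / 2) (h / 2) hp.1 hh' (mono V _ _ _ h1) (mono' V _ _ _ h2)
          (key V _ _ _ hV) (mono' V _ _ _ ?_))
        (ih _ _ α β (h / 2) (sub_nonneg.2 hp.2) hh' ?_ ?_ ?_ ?_)
      · rwa [add_assoc, add_halves]
      · rw [sub_re]; exact smono V _ _ _ h1
      · rw [sub_re]; exact smono' V _ _ _ h2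
      · rw [sub_im]; exact smono V _ _ _ h3
      · rw [sub_im]; exact key' V _ _ _ hV'
    obtain ⟨V, hV, hV'⟩ := exists_bandProj_sign (x.re - (α + h / 2) • e)
    have hp := Riesz.bandProj_nonneg_and_le (modulus '' V) he
    refine exists_stepLike_of_bandProj hD V he
      (half _ _ (α + h / 2) β hp.1 (key V _ _ _ hV) (mono' V _ _ _ ?_) (mono V _ _ _ h3)
        (mono' V _ _ _ h4))
      (half _ _ α β (sub_nonneg.2 hp.2) ?_ ?_ ?_ ?_)
    · rwa [add_assoc, add_halves]
    · rw [sub_re]; exact smono V _ _ _ h1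
    · rw [sub_re]; exact key' V _ _ _ hV'
    · rw [sub_im]; exact smono V _ _ _ h3
    · rw [sub_im]; exact smono' V _ _ _ h4

theorem exists_stepLike {D : Cpx E →L[ℂ] Cpx E} (hD : DisjointnessPreserving D) {x : Cpx E}
    {e : E} (hx : modulus x ≤ e) {δ : ℝ} (hδ : 0 < δ) :
    ∃ s, StepLike D s e ∧ modulus (x - s) ≤ δ • e := by
  have he : 0 ≤ e := (modulus_nonneg x).trans hx
  obtain ⟨n, hn⟩ := exists_pow_lt_of_lt_one (show (0 : ℝ) < δ / 4 by positivity)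
    (show (1 / 2 : ℝ) < 1 by norm_num)
  have hr := (abs_re_le_modulus x).trans hx
  have hi := (abs_im_le_modulus x).trans hx
  have hone : (-1 + 2 : ℝ) = 1 := by norm_num
  -- The square is `[-1, 1]²`, of side `2`, since both parts of `x` are bounded by `e`.
  obtain ⟨s, hs, hs'⟩ := exists_stepLike_of_mem_square hD n x e (-1) (-1) 2 he zero_le_two
    (by rw [neg_one_smul]; exact neg_le.1 ((neg_le_abs _).trans hr))
    (by rw [hone, one_smul]; exact (le_abs_self _).trans hr)
    (by rw [neg_one_smul]; exact neg_le.1 ((neg_le_abs _).trans hi))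
    (by rw [hone, one_smul]; exact (le_abs_self _).trans hi)
  refine ⟨s, hs, hs'.trans (smul_le_smul_of_nonneg_right ?_ he)⟩
  have : (2 * 2 / 2 ^ n : ℝ) = 4 * (1 / 2) ^ n := by
    rw [one_div, inv_pow]; ring
  rw [this]
  linarith

theorem nonpos_of_forall_le_mul {a K : ℝ} (h : ∀ δ : ℝ, 0 < δ → a ≤ δ * K) : a ≤ 0 := by
  have h1 : Filter.Tendsto (fun δ : ℝ => δ * K) (nhdsWithin 0 (Set.Ioi 0)) (nhds 0) := by
    have : Filter.Tendsto (fun δ : ℝ => δ * K) (nhds 0) (nhds (0 * K)) :=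
      (continuous_id.mul continuous_const).tendsto 0
    rw [zero_mul] at this
    exact this.mono_left nhdsWithin_le_nhds
  exact ge_of_tendsto h1 (by filter_upwards [self_mem_nhdsWithin] with δ hδ using h δ hδ)

theorem norm_map_sub_le (D : Cpx E →L[ℂ] Cpx E) {x s : Cpx E} {e : E} {δ : ℝ} (hδ : 0 < δ)
    (h : modulus (x - s) ≤ δ • e) : ‖D x - D s‖ ≤ δ * (‖D‖ * ‖e‖) := by
  rw [← map_sub]
  refine (D.le_opNorm _).trans ?_
  have h1 : ‖x - s‖ ≤ δ * ‖e‖ := by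
    have := norm_mono (modulus_nonneg (x - s)) h
    rwa [norm_smul, Real.norm_of_nonneg hδ.le] at this
  calc ‖D‖ * ‖x - s‖ ≤ ‖D‖ * (δ * ‖e‖) := by gcongr
    _ = δ * (‖D‖ * ‖e‖) := by ring

/-- True for step elements, whose pieces have disjoint images. Passing to the limit uses that `|s|`
approximates `|x|` whenever `s` approximates `x`. -/
theorem DisjointnessPreserving.modulus_map {D : Cpx E →L[ℂ] Cpx E}
    (hD : DisjointnessPreserving D) (x : Cpx E) :
    modulus (D x) = modulus (D (ofReal (modulus x))) := by
  rw [← sub_eq_zero, ← norm_le_zero_iff]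
  refine nonpos_of_forall_le_mul (K := ‖D‖ * ‖modulus x‖ + ‖D‖ * ‖modulus x‖) fun δ hδ => ?_
  obtain ⟨s, hs, hs'⟩ := exists_stepLike hD (le_refl (modulus x)) hδ
  have h1 := norm_map_sub_le D hδ hs'
  have h2 : modulus (ofReal (modulus x) - ofReal (modulus s)) ≤ δ • modulus x := by
    rw [← ofReal_sub, modulus_ofReal]
    exact (abs_modulus_sub_modulus_le x s).trans hs'
  have h3 := norm_map_sub_le D hδ h2
  have e1 : modulus (D x) - modulus (D (ofReal (modulus x))) =
      (modulus (D x) - modulus (D s)) -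
        (modulus (D (ofReal (modulus x))) - modulus (D (ofReal (modulus s)))) := by
    rw [hs.modulus_map]; abel
  rw [e1, mul_add]
  exact (norm_sub_le _ _).trans (add_le_add ((norm_modulus_sub_le _ _).trans h1)
    ((norm_modulus_sub_le _ _).trans h3))

/-- A step element `s` within `δ • e` of `x` has `|s| ≤ (1 + δ) e`, hence `|Ds| ≤ (1 + δ) |De|`. So
the positive part of `|Dx| - |De|` has norm at most a multiple of `δ`. -/
theorem DisjointnessPreserving.modulus_map_le {D : Cpx E →L[ℂ] Cpx E}
    (hD : DisjointnessPreserving D) {x y : Cpx E} (h : modulus x ≤ modulus y) :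
    modulus (D x) ≤ modulus (D y) := by
  rw [hD.modulus_map y, ← sub_nonpos]
  set e := modulus y
  set d := modulus (D (ofReal e))
  rw [← posPart_eq_zero, ← norm_le_zero_iff]
  refine nonpos_of_forall_le_mul (K := ‖d‖ + ‖D‖ * ‖e‖) fun δ hδ => ?_
  have he : 0 ≤ e := modulus_nonneg y
  have hd : 0 ≤ d := modulus_nonneg _
  obtain ⟨s, hs, hs'⟩ := exists_stepLike hD h hδ
  have h1 : modulus s ≤ (1 + δ) • e := by
    rw [add_smul, one_smul]
    calc modulus s = modulus (x - (x - s)) := by rw [sub_sub_cancel]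
      _ ≤ modulus x + modulus (x - s) := modulus_sub_le _ _
      _ ≤ e + δ • e := add_le_add h hs'
  have h2 := hs.dominated (1 + δ) (by positivity) h1
  rw [add_smul, one_smul] at h2
  have h3 : modulus (D x) - d ≤ δ • d + modulus (D x - D s) := by
    rw [sub_le_iff_le_add]
    calc modulus (D x) = modulus (D s + (D x - D s)) := by rw [add_sub_cancel]
      _ ≤ modulus (D s) + modulus (D x - D s) := modulus_add_le _ _
      _ ≤ (d + δ • d) + modulus (D x - D s) := by gcongr
      _ = δ • d + modulus (D x - D s) + d := by abel
  have h4 : (modulus (D x) - d)⁺ ≤ δ • d + modulus (D x - D s) :=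
    sup_le h3 (add_nonneg (smul_nonneg hδ.le hd) (modulus_nonneg _))
  refine (norm_mono (posPart_nonneg _) h4).trans ((norm_add_le _ _).trans ?_)
  rw [mul_add, norm_smul, Real.norm_of_nonneg hδ.le]
  exact add_le_add le_rfl (norm_map_sub_le D hδ hs')

/-- The form in which approximation in modulus is exploited: only the moduli of `x` and `y` need to
be close. -/
theorem DisjointnessPreserving.abs_norm_map_sub_norm_map_le {D : Cpx E →L[ℂ] Cpx E}
    (hD : DisjointnessPreserving D) (x y : Cpx E) :
    |‖D x‖ - ‖D y‖| ≤ ‖D‖ * ‖modulus x - modulus y‖ := by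
  have h1 : ∀ z, ‖D z‖ = ‖D (ofReal (modulus z))‖ := fun z => by
    rw [norm_def, hD.modulus_map z, ← norm_def]
  rw [h1 x, h1 y]
  refine (abs_norm_sub_norm_le _ _).trans ?_
  rw [← map_sub, ← ofReal_sub, ← norm_ofReal (modulus x - modulus y)]
  exact D.le_opNorm _

end Cpx

/-! ### Finite disjoint sums, and the transfer of lower bounds from an AIM subspace. -/

namespace Riesz

theorem sum_inf_eq_zero {E : Type*} [AddCommGroup E] [Lattice E] [IsOrderedAddMonoid E]
    {ι : Type*} {s : Finset ι} {f : ι → E} {b : E} (hb : 0 ≤ b) (hf : ∀ i ∈ s, 0 ≤ f i)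
    (h : ∀ i ∈ s, f i ⊓ b = 0) : (∑ i ∈ s, f i) ⊓ b = 0 := by
  classical
  induction s using Finset.induction_on with
  | empty => simpa using hb
  | insert a s ha ih =>
    rw [Finset.sum_insert ha]
    refine add_inf_eq_zero (hf a (Finset.mem_insert_self a s))
      (Finset.sum_nonneg fun i hi => hf i (Finset.mem_insert_of_mem hi))
      (h a (Finset.mem_insert_self a s))
      (ih (fun i hi => hf i (Finset.mem_insert_of_mem hi))
        fun i hi => h i (Finset.mem_insert_of_mem hi))

theorem sum_le_of_pairwise_inf_eq_zero {E : Type*} [AddCommGroup E] [Lattice E]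
    [IsOrderedAddMonoid E] {ι : Type*} {s : Finset ι} {f : ι → E} {b : E} (hb : 0 ≤ b)
    (hf : ∀ i ∈ s, 0 ≤ f i) (hfb : ∀ i ∈ s, f i ≤ b)
    (h : ∀ i ∈ s, ∀ j ∈ s, i ≠ j → f i ⊓ f j = 0) : ∑ i ∈ s, f i ≤ b := by
  classical
  induction s using Finset.induction_on with
  | empty => simpa using hb
  | insert a s ha ih =>
    have ha' := Finset.mem_insert_self a s
    have hs' : ∀ i ∈ s, i ∈ insert a s := fun i hi => Finset.mem_insert_of_mem hi
    rw [Finset.sum_insert ha]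
    refine add_le_of_inf_eq_zero ?_ (hfb a ha') (ih (fun i hi => hf i (hs' i hi))
      (fun i hi => hfb i (hs' i hi)) fun i hi j hj hij => h i (hs' i hi) j (hs' j hj) hij)
    rw [inf_comm]
    refine sum_inf_eq_zero (hf a ha') (fun i hi => hf i (hs' i hi)) fun i hi => ?_
    exact h i (hs' i hi) a ha' fun hia => ha (hia ▸ hi)

end Riesz

namespace Cpx

variable {E : Type*} [NormedAddCommGroup E] [ConditionallyCompleteLattice E]
  [IsOrderedAddMonoid E] [NormedSpace ℝ E] [IsOrderedModule ℝ E]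

theorem disj_iff_mem_polar {z w : Cpx E} : Disj z w ↔ z ∈ polar {w} := by
  simp [mem_polar]

theorem polar_polar_le {V W : Set (Cpx E)} (h : V ⊆ polar W) :
    polar (polar V : Set (Cpx E)) ≤ polar W := fun _ hz w hw =>
  hz w fun _ hv => (h hv w hw).symm

theorem Disj.sum_left {ι : Type*} {s : Finset ι} {f : ι → Cpx E} {w : Cpx E}
    (h : ∀ i ∈ s, Disj (f i) w) : Disj (∑ i ∈ s, f i) w :=
  disj_iff_mem_polar.2 (sum_mem fun i hi => disj_iff_mem_polar.1 (h i hi))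

theorem Disj.smul_left {z w : Cpx E} (c : ℂ) (h : Disj z w) : Disj (c • z) w :=
  disj_iff_mem_polar.2 (Submodule.smul_mem _ c (disj_iff_mem_polar.1 h))

theorem Disj.sub_left {z z' w : Cpx E} (h : Disj z w) (h' : Disj z' w) : Disj (z - z') w :=
  disj_iff_mem_polar.2 (sub_mem (disj_iff_mem_polar.1 h) (disj_iff_mem_polar.1 h'))

theorem modulus_sum_le {ι : Type*} (s : Finset ι) (f : ι → Cpx E) :
    modulus (∑ i ∈ s, f i) ≤ ∑ i ∈ s, modulus (f i) := by
  classical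
  induction s using Finset.induction_on with
  | empty => simp [modulus_zero]
  | insert a s ha ih =>
    rw [Finset.sum_insert ha, Finset.sum_insert ha]
    exact (modulus_add_le _ _).trans (add_le_add le_rfl ih)

theorem modulus_sum {ι : Type*} {s : Finset ι} {f : ι → Cpx E}
    (h : ∀ i ∈ s, ∀ j ∈ s, i ≠ j → Disj (f i) (f j)) :
    modulus (∑ i ∈ s, f i) = ∑ i ∈ s, modulus (f i) := by
  classical
  induction s using Finset.induction_on with
  | empty => simp [modulus_zero]
  | insert a s ha ih =>
    have hs' : ∀ i ∈ s, i ∈ insert a s := fun i hi => Finset.mem_insert_of_mem hi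
    rw [Finset.sum_insert ha, Finset.sum_insert ha, Disj.modulus_add,
      ih fun i hi j hj hij => h i (hs' i hi) j (hs' j hj) hij]
    refine (Disj.sum_left fun i hi => ?_).symm
    exact h i (hs' i hi) a (Finset.mem_insert_self a s) fun hia => ha (hia ▸ hi)

variable [HasSolidNorm E]

theorem disjointnessPreserving_of_modulus_le {D : Cpx E →L[ℂ] Cpx E}
    (h : ∀ x, modulus (D x) ≤ modulus x) : DisjointnessPreserving D := fun x y hxy =>
  Disj.mono hxy (h x) (h y)

theorem DisjointnessPreserving.comp {D D' : Cpx E →L[ℂ] Cpx E} (hD : DisjointnessPreserving D)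
    (hD' : DisjointnessPreserving D') : DisjointnessPreserving (D ∘L D') := fun x y hxy =>
  hD _ _ (hD' x y hxy)

theorem disjointnessPreserving_one : DisjointnessPreserving (1 : Cpx E →L[ℂ] Cpx E) :=
  fun _ _ h => h

theorem DisjointnessPreserving.pow {D : Cpx E →L[ℂ] Cpx E} (hD : DisjointnessPreserving D)
    (n : ℕ) : DisjointnessPreserving (D ^ n) := by
  induction n with
  | zero => exact disjointnessPreserving_one
  | succ n ih => rw [pow_succ]; exact ih.comp hD

theorem disjointnessPreserving_bandProj (V : Set (Cpx E)) :
    DisjointnessPreserving (bandProj V) :=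
  disjointnessPreserving_of_modulus_le (modulus_bandProj_le V)

theorem disjointnessPreserving_one_sub_bandProj (V : Set (Cpx E)) :
    DisjointnessPreserving (1 - bandProj V) :=
  disjointnessPreserving_of_modulus_le (modulus_sub_bandProj_le V)

theorem IsCentral.disjointnessPreserving {A : Cpx E →L[ℂ] Cpx E} (hA : IsCentral A) :
    DisjointnessPreserving A := by
  obtain ⟨c, hc, hA⟩ := hA
  intro x y hxy
  exact ((Disj.mono_smul hxy hc (hA x)).symm.mono_smul hc (hA y)).symm

theorem IsCentral.disj {A : Cpx E →L[ℂ] Cpx E} (hA : IsCentral A) {x y : Cpx E}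
    (h : Disj x y) : Disj (A x) y := by
  obtain ⟨c, hc, hA⟩ := hA
  exact h.mono_smul hc (hA x)

/-- A lower estimate on an AIM subspace passes to the whole band generated by `V`. -/
theorem IsAIM.lower_bound_of_disjointnessPreserving {Y : Submodule ℂ (Cpx E)} (hY : IsAIM Y)
    {W₁ W₂ : Cpx E →L[ℂ] Cpx E} {V : Set (Cpx E)}
    (h₁ : DisjointnessPreserving (W₁ ∘L bandProj V))
    (h₂ : DisjointnessPreserving (W₂ ∘L bandProj V)) {c : ℝ} (hc : 0 ≤ c)
    (h : ∀ y ∈ Y, c * ‖W₂ y‖ ≤ ‖W₁ y‖) {u : Cpx E} (hu : u ∈ polar (polar V : Set (Cpx E))) :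
    c * ‖W₂ u‖ ≤ ‖W₁ u‖ := by
  have hPu := bandProj_of_mem hu
  set P := bandProj V
  set Q : Cpx E →L[ℂ] Cpx E := 1 - P with hQ
  have hQu : Q u = 0 := by simp [hQ, hPu]
  have hdec : ∀ W : Cpx E →L[ℂ] Cpx E, ∀ y, W y = (W ∘L P) y + W (Q y) := fun W y => by
    simp [hQ]
  rw [← sub_nonpos]
  refine nonpos_of_forall_le_mul (K := c * (‖W₂ ∘L P‖ + ‖W₂‖ * ‖Q‖) +
    (‖W₁ ∘L P‖ + ‖W₁‖ * ‖Q‖)) fun ε hε => ?_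
  obtain ⟨y, hy, hyu⟩ := hY.approx u ε hε
  -- The approximant `y` need not lie in the band. But `Q` preserves disjointness and `Q u = 0`, so
  -- closeness of moduli makes the part of `y` outside the band small.
  have hQy : ‖Q y‖ ≤ ‖Q‖ * ε := by
    have h3 := (disjointnessPreserving_one_sub_bandProj V).abs_norm_map_sub_norm_map_le u y
    rw [show (1 - bandProj V : Cpx E →L[ℂ] Cpx E) = Q from rfl, hQu, norm_zero, zero_sub, abs_neg,
      abs_of_nonneg (norm_nonneg _)] at h3
    exact h3.trans (by gcongr)
  have est : ∀ W : Cpx E →L[ℂ] Cpx E, DisjointnessPreserving (W ∘L P) →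
      |‖W u‖ - ‖W y‖| ≤ ε * (‖W ∘L P‖ + ‖W‖ * ‖Q‖) := by
    intro W hW
    have h1 := hW.abs_norm_map_sub_norm_map_le u y
    have h2 : (W ∘L P) u = W u := by simp [hPu]
    rw [h2] at h1
    have h4 : |‖(W ∘L P) y‖ - ‖W y‖| ≤ ‖W‖ * (‖Q‖ * ε) := by
      refine (abs_norm_sub_norm_le _ _).trans ?_
      rw [hdec W y, sub_add_cancel_left, norm_neg]
      exact (W.le_opNorm _).trans (by gcongr)
    have h5 : ‖W ∘L P‖ * ‖modulus u - modulus y‖ ≤ ‖W ∘L P‖ * ε := by gcongr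
    have h6 := abs_sub_le ‖W u‖ ‖(W ∘L P) y‖ ‖W y‖
    nlinarith
  have e1 := (abs_le.1 (est W₁ h₁)).1
  have e2 := (abs_le.1 (est W₂ h₂)).2
  have e3 := h y hy
  have e4 := mul_le_mul_of_nonneg_left e2 hc
  linarith [mul_add ε (c * (‖W₂ ∘L P‖ + ‖W₂‖ * ‖Q‖)) (‖W₁ ∘L P‖ + ‖W₁‖ * ‖Q‖)]

theorem modulus_bandProj_le_of_le (V : Set (Cpx E)) {x y : Cpx E} (h : modulus x ≤ modulus y) :
    modulus (bandProj V x) ≤ modulus (bandProj V y) :=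
  (disjointnessPreserving_bandProj V).modulus_map_le h

/-- The bands are removed one after another: `z` is what remains of `x` after all the projections.
When the bands cover `x`, the remainder vanishes and `|x|` is bounded by the sum of its pieces. -/
theorem exists_modulus_le_add_sum {ι : Type*} (s : Finset ι) (V : ι → Set (Cpx E)) (x : Cpx E) :
    ∃ z, modulus z ≤ modulus x ∧ (∀ i ∈ s, z ∈ polar (V i)) ∧
      modulus x ≤ modulus z + ∑ i ∈ s, modulus (bandProj (V i) x) := by
  classical
  induction s using Finset.induction_on with
  | empty => exact ⟨x, le_rfl, by simp, by simp⟩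
  | insert a s ha ih =>
    obtain ⟨z, hz, hzV, hxz⟩ := ih
    have hle := modulus_sub_bandProj_le (V a) z
    refine ⟨z - bandProj (V a) z, hle.trans hz, ?_, ?_⟩
    · intro i hi
      rcases Finset.mem_insert.1 hi with rfl | hi
      · exact sub_bandProj_mem _ _
      · exact mem_polar_of_modulus_le (hzV i hi) hle
    · rw [Finset.sum_insert ha, ← add_assoc]
      refine hxz.trans (add_le_add ?_ le_rfl)
      rw [modulus_eq_bandProj_add (V a) z, add_comm]
      exact add_le_add le_rfl (modulus_bandProj_le_of_le _ hz)

/-! ### Iterates of `A ∘L S` on wandering sets. -/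

section Iterates

variable {S A T : Cpx E →L[ℂ] Cpx E}

/-- The inverse of `S` also preserves disjointness: by monotonicity `S` sends `|x| ⊓ |y|` to an
element dominated by both `Sx` and `Sy`, so its image is zero, and `S` is injective. -/
theorem IsDIsomorphism.disj_iff (hS : IsDIsomorphism S) {x y : Cpx E} :
    Disj (S x) (S y) ↔ Disj x y := by
  refine ⟨fun h => ?_, hS.disjointnessPreserving x y⟩
  have h0 : 0 ≤ modulus x ⊓ modulus y := le_inf (modulus_nonneg x) (modulus_nonneg y)
  have hm := modulus_ofReal_of_nonneg h0
  have h1 : modulus (S (ofReal (modulus x ⊓ modulus y))) ≤ modulus (S x) :=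
    hS.disjointnessPreserving.modulus_map_le (hm.trans_le inf_le_left)
  have h2 : modulus (S (ofReal (modulus x ⊓ modulus y))) ≤ modulus (S y) :=
    hS.disjointnessPreserving.modulus_map_le (hm.trans_le inf_le_right)
  have h3 := (h.mono h1 h2).eq_zero
  rw [← map_zero S] at h3
  have h4 := hS.bijective.1 h3
  rw [h4, modulus_zero] at hm
  exact hm.symm

theorem IsDIsomorphism.pow (hS : IsDIsomorphism S) (n : ℕ) : IsDIsomorphism (S ^ n) := by
  refine ⟨?_, hS.disjointnessPreserving.pow n⟩
  rw [FunLike.coe_pow_eq_iterate]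
  exact hS.bijective.iterate n

theorem disj_comp_of_disj (hA : IsCentral A) {v w : Cpx E} (h : Disj v (S w)) :
    Disj v ((A ∘L S) w) := (hA.disj h.symm).symm

/-- A central factor never enlarges a band, so the weights may be inserted one at a time.
Surjectivity of `S` allows one application of it to be stripped from both sides. -/
theorem disj_pow_of_disj (hS : IsDIsomorphism S) (hA : IsCentral A) (j : ℕ) :
    ∀ {v w : Cpx E}, Disj v ((S ^ j) w) → Disj v (((A ∘L S) ^ j) w) := by
  induction j with
  | zero => exact fun h => h
  | succ j ih =>
    intro v w h
    obtain ⟨v, rfl⟩ := hS.bijective.2 v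
    rw [pow_succ'] at h ⊢
    exact disj_comp_of_disj hA (hS.disj_iff.2 (ih (hS.disj_iff.1 h)))

/-- `V` is disjoint from its images under the first `k` iterates of `S`. -/
def Wandering (S : Cpx E →L[ℂ] Cpx E) (k : ℕ) (V : Set (Cpx E)) : Prop :=
  ∀ v ∈ V, ∀ w ∈ V, ∀ i, 1 ≤ i → i ≤ k → Disj v ((S ^ i) w)

theorem Wandering.mono {k : ℕ} {V W : Set (Cpx E)} (h : Wandering S k W) (hVW : V ⊆ W) :
    Wandering S k V := fun v hv w hw => h v (hVW hv) w (hVW hw)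

theorem Wandering.polar_polar (hS : IsDIsomorphism S) {k : ℕ} {V : Set (Cpx E)}
    (h : Wandering S k V) : Wandering S k (polar (polar V : Set (Cpx E))) := by
  intro v hv w hw i hi hik
  have h1 : ∀ u ∈ V, Disj v ((S ^ i) u) := fun u hu =>
    hv _ fun u' hu' => (h u' hu' u hu i hi hik).symm
  obtain ⟨v', rfl⟩ := (hS.pow i).bijective.2 v
  exact (hS.pow i).disj_iff.2 (hw v' fun u hu => (hS.pow i).disj_iff.1 (h1 u hu)).symm

theorem pow_add_apply (D : Cpx E →L[ℂ] Cpx E) (m n : ℕ) (x : Cpx E) :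
    (D ^ (m + n)) x = (D ^ m) ((D ^ n) x) := by
  rw [pow_add]; rfl

theorem Wandering.image (hS : IsDIsomorphism S) {k : ℕ} {V : Set (Cpx E)}
    (h : Wandering S k V) (j : ℕ) : Wandering S k ((S ^ j) '' V) := by
  rintro _ ⟨v, hv, rfl⟩ _ ⟨w, hw, rfl⟩ i hi hik
  rw [← pow_add_apply, add_comm, pow_add_apply]
  exact (hS.pow j).disj_iff.2 (h v hv w hw i hi hik)

theorem IsDIsomorphism.disjointnessPreserving_comp (hS : IsDIsomorphism S) (hA : IsCentral A) :
    DisjointnessPreserving (A ∘L S) :=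
  hA.disjointnessPreserving.comp hS.disjointnessPreserving

theorem Wandering.disj_pow (hS : IsDIsomorphism S) (hA : IsCentral A) {k : ℕ}
    {V : Set (Cpx E)} (h : Wandering S k V) {v w : Cpx E} (hv : v ∈ V) (hw : w ∈ V) {i j : ℕ}
    (hi : i ≤ k) (hj : j ≤ k) (hij : i ≠ j) :
    Disj (((A ∘L S) ^ i) v) (((A ∘L S) ^ j) w) := by
  have key : ∀ {v w : Cpx E}, v ∈ V → w ∈ V → ∀ {i j : ℕ}, j ≤ k → i < j →
      Disj (((A ∘L S) ^ i) v) (((A ∘L S) ^ j) w) := by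
    intro v w hv hw i j hj hij
    obtain ⟨l, rfl⟩ := Nat.exists_eq_add_of_lt hij
    rw [add_assoc, pow_add_apply]
    exact (hS.disjointnessPreserving_comp hA).pow i _ _
      (disj_pow_of_disj hS hA _ (h v hv w hw _ (by omega) (by omega)))
  rcases lt_or_gt_of_ne hij with hlt | hlt
  · exact key hv hw hj hlt
  · exact (key hw hv hi hlt).symm

/-- In comparing the images of two disjoint vectors, cross terms with distinct exponents are
disjoint because the band is wandering; terms with equal exponents are disjoint because each power
preserves disjointness. -/
theorem Wandering.disjointnessPreserving_sum (hS : IsDIsomorphism S) (hA : IsCentral A) {k : ℕ}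
    {V : Set (Cpx E)} (h : Wandering S k V) {s : Finset ℕ} (hs : ∀ i ∈ s, i ≤ k) (a : ℕ → ℂ) :
    DisjointnessPreserving ((∑ i ∈ s, a i • (A ∘L S) ^ i) ∘L bandProj V) := by
  intro x y hxy
  have hPxy : Disj (bandProj V x) (bandProj V y) := disjointnessPreserving_bandProj V x y hxy
  have hx := bandProj_mem V x
  have hy := bandProj_mem V y
  simp only [ContinuousLinearMap.comp_apply, sum_apply,
    smul_apply]
  refine Disj.sum_left fun i hi => (Disj.sum_left fun j hj => ?_).symm
  refine (Disj.smul_left _ ?_).symm.smul_left _ |>.symm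
  rcases eq_or_ne i j with rfl | hij
  · exact Disj.symm ((hS.disjointnessPreserving_comp hA).pow i _ _ hPxy)
  · exact (h.polar_polar hS).disj_pow hS hA hy hx (hs j hj) (hs i hi) hij.symm

end Iterates

end Cpx

/-! ### Periodic and aperiodic bands, and the estimate for an exact period. -/

namespace Cpx

variable {E : Type*} [NormedAddCommGroup E] [ConditionallyCompleteLattice E]
  [IsOrderedAddMonoid E] [NormedSpace ℝ E] [IsOrderedModule ℝ E] [HasSolidNorm E]
  {S A : Cpx E →L[ℂ] Cpx E}

theorem pow_comm_apply (D : Cpx E →L[ℂ] Cpx E) (m n : ℕ) (x : Cpx E) :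
    (D ^ m) ((D ^ n) x) = (D ^ n) ((D ^ m) x) := by
  rw [← pow_add_apply, ← pow_add_apply, add_comm]

/-- The band on which `S ^ p` preserves all bands. -/
def periodicBand (S : Cpx E →L[ℂ] Cpx E) (p : ℕ) : Submodule ℂ (Cpx E) :=
  polar {z | Disj z ((S ^ p) z)}

/-- Write `w = S ^ p u`. The part `z` of `w` outside the band of `u` satisfies `z ⊥ S ^ p z`, so it
is disjoint from `w` by definition of the periodic band, hence zero. Thus `w` lies in the band
generated by `u`, and applying `S ^ p` gives the claim. -/
theorem disj_pow_of_mem_periodicBand (hS : IsDIsomorphism S) {p : ℕ} {v w : Cpx E}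
    (hw : w ∈ periodicBand S p) (h : Disj v w) : Disj v ((S ^ p) w) := by
  have hSp := hS.pow p
  obtain ⟨u, hu⟩ := hSp.bijective.2 w
  set z := w - bandProj {u} w with hz
  have hzw : modulus z ≤ modulus w := modulus_sub_bandProj_le {u} w
  have hzu : Disj z u := sub_bandProj_mem {u} w u rfl
  have h1 : Disj ((S ^ p) z) w := by rw [← hu]; exact hSp.disj_iff.2 hzu
  have h2 : Disj z ((S ^ p) z) := (h1.mono le_rfl hzw).symm
  have h3 : z = 0 := ((hw z h2).mono hzw le_rfl).eq_zero
  have h4 : w ∈ polar (polar {u} : Set (Cpx E)) := by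
    rw [sub_eq_zero.1 h3]
    exact bandProj_mem {u} w
  obtain ⟨v, rfl⟩ := hSp.bijective.2 v
  rw [← hu] at h
  exact hSp.disj_iff.2 (h4 v (disj_iff_mem_polar.1 (hSp.disj_iff.1 h))).symm

/-- The band on which `S` has no periodic part of period at most `k`. -/
def aperiodicBand (S : Cpx E →L[ℂ] Cpx E) (k : ℕ) : Set (Cpx E) :=
  {x | ∀ q, 1 ≤ q → q ≤ k → x ∈ polar (periodicBand S q : Set (Cpx E))}

theorem mem_aperiodicBand_of_modulus_le {k : ℕ} {x y : Cpx E} (hy : y ∈ aperiodicBand S k)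
    (h : modulus x ≤ modulus y) : x ∈ aperiodicBand S k := fun q hq hqk =>
  mem_polar_of_modulus_le (hy q hq hqk) h

/-- A minorant `w` good for `k` cannot lie in the band of period `k + 1`, being below `z`. So it
meets some `g` with `g ⊥ S ^ (k + 1) g`, and `|w| ⊓ |g|` inherits both properties. -/
theorem exists_wandering_minorant (hS : IsDIsomorphism S) {k : ℕ} {z : Cpx E}
    (hz : z ∈ aperiodicBand S k) (hz0 : z ≠ 0) :
    ∃ w, w ≠ 0 ∧ modulus w ≤ modulus z ∧ ∀ i, 1 ≤ i → i ≤ k → Disj w ((S ^ i) w) := by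
  induction k with
  | zero => exact ⟨z, hz0, le_rfl, fun i h1 h2 => by omega⟩
  | succ k ih =>
    obtain ⟨w, hw0, hwz, hw⟩ := ih fun q hq hqk => hz q hq (by omega)
    have h1 : w ∉ periodicBand S (k + 1) := fun h =>
      hw0 ((hz (k + 1) (by omega) le_rfl w h).mono hwz le_rfl).eq_zero
    rw [periodicBand, mem_polar] at h1
    push Not at h1
    obtain ⟨g, hg, hwg⟩ := h1
    have h0 : 0 ≤ modulus w ⊓ modulus g := le_inf (modulus_nonneg w) (modulus_nonneg g)
    have hm := modulus_ofReal_of_nonneg h0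
    have hmw := hm.trans_le inf_le_left
    have hmg := hm.trans_le inf_le_right
    refine ⟨ofReal (modulus w ⊓ modulus g), fun h => hwg ?_, hmw.trans hwz, fun i hi hik => ?_⟩
    · rw [h, modulus_zero] at hm
      exact hm.symm
    · have hmono := fun {y : Cpx E} => (hS.pow i).disjointnessPreserving.modulus_map_le
        (x := ofReal (modulus w ⊓ modulus g)) (y := y)
      rcases Nat.lt_or_ge k i with hki | hki
      · obtain rfl : i = k + 1 := by omega
        exact Disj.mono hg hmg (hmono hmg)
      · exact (hw i hi hki).mono hmw (hmono hmw)

/-- By Zorn there is a maximal wandering set. A nonzero `z` disjoint from all its translates by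
exponents from `-k` to `k` would have a wandering minorant that could be adjoined to it. -/
theorem exists_wandering_cover (hS : IsDIsomorphism S) (k L : ℕ) :
    ∃ U : Set (Cpx E), Wandering S k U ∧ ∀ z ∈ aperiodicBand S k,
      (∀ r ≤ 2 * k, z ∈ polar ((S ^ (L + r)) '' U)) → z = 0 := by
  obtain ⟨U, hU⟩ := zorn_subset {U : Set (Cpx E) | Wandering S k U} fun c hc hchain => by
    refine ⟨⋃₀ c, ?_, fun s hs => Set.subset_sUnion_of_mem hs⟩
    rintro v ⟨s, hs, hv⟩ w ⟨t, ht, hw⟩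
    rcases hchain.total hs ht with hst | hst
    · exact hc ht v (hst hv) w hw
    · exact hc hs v hv w (hst hw)
  have hUW : Wandering S k U := hU.prop
  -- Shifting the maximal set back turns the exponents `-k, …, k` into `L, …, L + 2 * k`, so that
  -- only nonnegative powers occur. The offset `L` leaves room below for the first window of the
  -- aperiodic estimate.
  refine ⟨(S ^ (L + k)) ⁻¹' U, ?_, fun z hz h => ?_⟩
  · intro v hv w hw i hi hik
    rw [← (hS.pow (L + k)).disj_iff, pow_comm_apply]
    exact hUW _ hv _ hw i hi hik
  · by_contra hz0
    obtain ⟨w, hw0, hwz, hw⟩ := exists_wandering_minorant hS hz hz0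
    have h' : ∀ r ≤ 2 * k, ∀ u, (S ^ (L + k)) u ∈ U → Disj w ((S ^ (L + r)) u) :=
      fun r hr u hu => (h r hr _ ⟨u, hu, rfl⟩).mono hwz le_rfl
    have hins : Wandering S k (insert w U) := by
      rintro v (rfl | hv) v' (rfl | hv') i hi hik
      · exact hw i hi hik
      · obtain ⟨u, rfl⟩ := (hS.pow (L + k)).bijective.2 v'
        rw [← pow_add_apply, show i + (L + k) = L + (k + i) by omega]
        exact h' _ (by omega) u hv'
      · obtain ⟨u, rfl⟩ := (hS.pow (L + k)).bijective.2 v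
        rw [show L + k = i + (L + (k - i)) by omega, pow_add_apply]
        exact (hS.pow i).disj_iff.2 (h' _ (by omega) u hv).symm
      · exact hUW v hv v' hv' i hi hik
    have hwU : w ∈ U := hU.le_of_ge hins (Set.subset_insert w U) (Set.mem_insert w U)
    obtain ⟨u, rfl⟩ := (hS.pow (L + k)).bijective.2 w
    exact hw0 (h' k (by omega) u hwU).eq_zero

/-- `S` carries the band generated by `(S ^ j) '' U` and its complement to those of `(S ^ (j + 1))
'' U`, and `A` preserves both. -/
theorem comp_bandProj_image (hS : IsDIsomorphism S) (hA : IsCentral A) (U : Set (Cpx E)) (j : ℕ)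
    (x : Cpx E) : (A ∘L S) (bandProj ((S ^ j) '' U) x) =
      bandProj ((S ^ (j + 1)) '' U) ((A ∘L S) x) := by
  refine (bandProj_eq ?_ ?_).symm
  · intro w hw
    refine (disj_comp_of_disj hA ?_).symm
    obtain ⟨w, rfl⟩ := hS.bijective.2 w
    refine hS.disj_iff.2 (bandProj_mem _ x w ?_).symm
    rintro _ ⟨u, hu, rfl⟩
    rw [← hS.disj_iff]
    have h1 : Disj (S w) ((S ^ (j + 1)) u) := hw _ (Set.mem_image_of_mem _ hu)
    rwa [pow_succ'] at h1
  · rw [← map_sub]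
    rintro _ ⟨u, hu, rfl⟩
    refine (disj_comp_of_disj hA ?_).symm
    rw [pow_succ']
    exact hS.disj_iff.2 (Disj.symm
      (sub_bandProj_mem ((S ^ j) '' U) x _ (Set.mem_image_of_mem _ hu)))

theorem pow_bandProj_image (hS : IsDIsomorphism S) (hA : IsCentral A) (U : Set (Cpx E))
    (i j : ℕ) (x : Cpx E) : ((A ∘L S) ^ i) (bandProj ((S ^ j) '' U) x) =
      bandProj ((S ^ (j + i)) '' U) (((A ∘L S) ^ i) x) := by
  induction i with
  | zero => rfl
  | succ i ih =>
    rw [pow_succ']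
    change (A ∘L S) (((A ∘L S) ^ i) _) = _
    rw [ih, comp_bandProj_image hS hA]
    rfl

theorem pow_mem {T : Cpx E →L[ℂ] Cpx E} {Y : Submodule ℂ (Cpx E)} (hTY : ∀ y ∈ Y, T y ∈ Y)
    (i : ℕ) {y : Cpx E} (hy : y ∈ Y) : (T ^ i) y ∈ Y := by
  induction i with
  | zero => exact hy
  | succ i ih => rw [pow_succ']; exact hTY _ ih

theorem pow_sub_one_eq (T : Cpx E →L[ℂ] Cpx E) (i : ℕ) (x : Cpx E) :
    (T ^ i) x - x = (∑ l ∈ Finset.range i, T ^ l) (T x - x) := by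
  have h := congrArg (fun D : Cpx E →L[ℂ] Cpx E => D x) (geom_sum_mul T i)
  exact h.symm

theorem norm_pow_sub_le (T : Cpx E →L[ℂ] Cpx E) (i : ℕ) (x : Cpx E) :
    ‖(T ^ i) x - x‖ ≤ ‖∑ l ∈ Finset.range i, T ^ l‖ * ‖T x - x‖ := by
  rw [pow_sub_one_eq]
  exact ContinuousLinearMap.le_opNorm _ _

theorem image_periodicBand (hS : IsDIsomorphism S) (p : ℕ) :
    S '' (periodicBand S p : Set (Cpx E)) = periodicBand S p := by
  have hcomm : ∀ z, (S ^ p) (S z) = S ((S ^ p) z) := fun z => by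
    have := pow_comm_apply S p 1 z
    rwa [pow_one] at this
  refine Set.Subset.antisymm ?_ fun w hw => ?_
  · rintro _ ⟨w, hw, rfl⟩ z hz
    obtain ⟨z, rfl⟩ := hS.bijective.2 z
    rw [Set.mem_ofPred_eq, hcomm, hS.disj_iff] at hz
    exact hS.disj_iff.2 (hw z hz)
  · obtain ⟨w, rfl⟩ := hS.bijective.2 w
    refine ⟨w, fun z hz => hS.disj_iff.1 (hw (S z) ?_), rfl⟩
    rw [Set.mem_ofPred_eq, hcomm, hS.disj_iff]
    exact hz

/-- The lower estimate on the band of vectors of exact period `k + 1`. -/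
theorem exists_lower_bound_periodic (hS : IsDIsomorphism S) (hA : IsCentral A)
    {Y : Submodule ℂ (Cpx E)} (hY : IsAIM Y) (hTY : ∀ y ∈ Y, (A ∘L S) y ∈ Y) {c : ℝ} (hc : 0 < c)
    (h : ∀ y ∈ Y, c * ‖y‖ ≤ ‖(A ∘L S) y - y‖) (k : ℕ) :
    ∃ C : ℝ, 0 ≤ C ∧ ∀ x ∈ aperiodicBand S k, x ∈ periodicBand S (k + 1) →
      ‖x‖ ≤ C * ‖(A ∘L S) x - x‖ := by
  set T := A ∘L S with hT
  obtain ⟨U, hU, hcov⟩ := exists_wandering_cover hS k 0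
  set R : Cpx E →L[ℂ] Cpx E := ∑ l ∈ Finset.range (k + 1), T ^ l with hR
  -- There are `2 * k + 1` covering bands, and the piece of `x` in each has norm at most `c⁻¹ * ‖R‖
  -- * ‖T x - x‖`.
  refine ⟨(2 * k + 1) * (c⁻¹ * ‖R‖), by positivity, fun x hxk hxp => ?_⟩
  set D : Cpx E →L[ℂ] Cpx E := T ^ (k + 1) - 1 with hD
  have hDapp : ∀ y, D y = R (T y - y) := pow_sub_one_eq T (k + 1)
  have hDdp : ∀ u ∈ periodicBand S (k + 1), DisjointnessPreserving (D ∘L bandProj {u}) := by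
    intro u hu v w hvw
    have hmem : ∀ y, bandProj {u} y ∈ periodicBand S (k + 1) := fun y =>
      polar_polar_le (Set.singleton_subset_iff.2 hu) (bandProj_mem {u} y)
    have hstep : ∀ {a b : Cpx E}, b ∈ periodicBand S (k + 1) → Disj a b → Disj a (D b) := by
      intro a b hb hab
      exact (Disj.sub_left (disj_pow_of_disj hS hA _ (disj_pow_of_mem_periodicBand hS hb hab)).symm
        hab.symm).symm
    have h1 : Disj (bandProj {u} v) (bandProj {u} w) := disjointnessPreserving_bandProj _ _ _ hvw
    exact hstep (hmem w) (hstep (hmem v) h1.symm).symm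
  have hpart : ∀ r : ℕ, ‖bandProj ((S ^ (0 + r)) '' U) x‖ ≤ c⁻¹ * ‖R‖ * ‖T x - x‖ := by
    intro r
    set u := bandProj ((S ^ (0 + r)) '' U) x with hu
    have hux : modulus u ≤ modulus x := modulus_bandProj_le _ x
    have huW : Wandering S k {u} := ((hU.image hS (0 + r)).polar_polar hS).mono
      (Set.singleton_subset_iff.2 (bandProj_mem _ x))
    have hup : u ∈ periodicBand S (k + 1) := mem_polar_of_modulus_le hxp hux
    have huu : u ∈ polar (polar {u} : Set (Cpx E)) := subset_polar_polar rfl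
    have hRdp : DisjointnessPreserving (R ∘L bandProj {u}) := by
      have h1 := huW.disjointnessPreserving_sum hS hA (s := Finset.range (k + 1))
        (fun i hi => by rw [Finset.mem_range] at hi; omega) fun _ => 1
      simpa only [one_smul] using h1
    -- On the band of `u`, `R` preserves disjointness since `u` is wandering, and `D` since `u` is
    -- periodic. The bound on `Y` is applied to `R y`, using `(T - 1) R = D`.
    have h1 : c * ‖R u‖ ≤ ‖D u‖ := by
      refine hY.lower_bound_of_disjointnessPreserving (hDdp u hup) hRdp hc.le (fun y hy => ?_) huu
      have hRy : R y ∈ Y := by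
        rw [hR, sum_apply]
        exact sum_mem fun i _ => pow_mem hTY i hy
      have h2 := h _ hRy
      have h3 : T (R y) - R y = D y :=
        congrArg (fun D : Cpx E →L[ℂ] Cpx E => D y) (mul_geom_sum T (k + 1))
      rwa [h3] at h2
    -- `u` is the zeroth of the disjoint summands of `R u`.
    have h2 : ‖u‖ ≤ ‖R u‖ := by
      refine norm_le_of_modulus_le ?_
      rw [hR, sum_apply, modulus_sum]
      · exact Finset.single_le_sum (f := fun i => modulus ((T ^ i) u))
          (fun i _ => modulus_nonneg _) (Finset.mem_range.2 (Nat.succ_pos k))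
      · intro i hi j hj hij
        rw [Finset.mem_range] at hi hj
        exact huW.disj_pow hS hA rfl rfl (by omega) (by omega) hij
    have h3 : ‖D u‖ ≤ ‖D x‖ := by
      refine norm_le_of_modulus_le ?_
      have h4 := (hDdp x hxp).modulus_map_le hux
      have hxx : x ∈ polar (polar {x} : Set (Cpx E)) := subset_polar_polar rfl
      rw [ContinuousLinearMap.comp_apply, ContinuousLinearMap.comp_apply, bandProj_of_mem hxx,
        bandProj_of_mem (mem_polar_of_modulus_le hxx hux)] at h4
      exact h4
    have h4 : ‖D x‖ ≤ ‖R‖ * ‖T x - x‖ := by rw [hDapp]; exact R.le_opNorm _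
    have h5 : c * ‖u‖ ≤ ‖R‖ * ‖T x - x‖ :=
      (mul_le_mul_of_nonneg_left h2 hc.le).trans (h1.trans (h3.trans h4))
    rw [mul_assoc]
    exact (le_inv_mul_iff₀ hc).2 h5
  obtain ⟨z, hzx, hz, hxz⟩ := exists_modulus_le_add_sum (Finset.range (2 * k + 1))
    (fun r : ℕ => (S ^ (0 + r)) '' U) x
  have hz0 : z = 0 := hcov z (mem_aperiodicBand_of_modulus_le hxk hzx) fun r hr =>
    hz r (Finset.mem_range.2 (by omega))
  rw [hz0, modulus_zero, zero_add] at hxz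
  calc ‖x‖ ≤ ‖∑ r ∈ Finset.range (2 * k + 1), modulus (bandProj ((S ^ (0 + r)) '' U) x)‖ :=
        norm_mono (modulus_nonneg x) hxz
    _ ≤ ∑ r ∈ Finset.range (2 * k + 1), ‖bandProj ((S ^ (0 + r)) '' U) x‖ := norm_sum_le _ _
    _ ≤ ∑ r ∈ Finset.range (2 * k + 1), c⁻¹ * ‖R‖ * ‖T x - x‖ :=
        Finset.sum_le_sum fun r _ => hpart r
    _ = (2 * k + 1) * (c⁻¹ * ‖R‖) * ‖T x - x‖ := by
        rw [Finset.sum_const, Finset.card_range, nsmul_eq_mul]; push_cast; ring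

end Cpx

/-! ### Towers with hat weights, the aperiodic estimate, and the conclusion. -/

namespace Cpx

/-- The hat function of height `2` and slope `1 / N` on `{0, …, 4 N}`. -/
noncomputable def hat (N i : ℕ) : ℝ := min (i : ℝ) (4 * N - i) / N

theorem hat_zero (N : ℕ) : hat N 0 = 0 := by
  simp [hat]

theorem hat_top (N : ℕ) : hat N (4 * N) = 0 := by
  simp [hat]

theorem hat_nonneg {N i : ℕ} (hi : i ≤ 4 * N) : 0 ≤ hat N i := by
  have h : (i : ℝ) ≤ 4 * N := by exact_mod_cast hi
  exact div_nonneg (le_min (Nat.cast_nonneg i) (sub_nonneg.2 h)) (Nat.cast_nonneg N)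

theorem one_le_hat {N i : ℕ} (hN : 0 < N) (hi : N ≤ i) (hi' : i ≤ 3 * N) : 1 ≤ hat N i := by
  have h : (N : ℝ) ≤ i := by exact_mod_cast hi
  have h' : (i : ℝ) ≤ 3 * N := by exact_mod_cast hi'
  have h0 : (0 : ℝ) < N := by exact_mod_cast hN
  rw [hat, one_le_div h0]
  exact le_min h (by linarith)

theorem abs_hat_sub_hat_le (N i : ℕ) : |hat N (i - 1) - hat N i| ≤ (N : ℝ)⁻¹ := by
  rcases Nat.eq_zero_or_pos i with rfl | hi
  · simp
  · obtain ⟨i, rfl⟩ := Nat.exists_eq_add_of_le' hi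
    rw [Nat.add_sub_cancel, hat, hat, ← sub_div, abs_div, Nat.abs_cast, div_eq_mul_inv]
    refine mul_le_of_le_one_left (by positivity) ?_
    refine (abs_min_sub_min_le_max _ _ _ _).trans (max_le ?_ ?_)
    · push_cast
      rw [sub_add_cancel_left, abs_neg, abs_one]
    · push_cast
      rw [show (4 * (N : ℝ) - i - (4 * N - (i + 1))) = 1 by ring, abs_one]

/-- Summation by parts; the boundary terms vanish because the hat is zero at both ends. This also
makes the truncated `0 - 1 = 0` harmless. -/
theorem sub_one_mul_sum_hat {R : Type*} [Ring R] [Algebra ℂ R] (T : R) (N : ℕ) :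
    (T - 1) * ∑ i ∈ Finset.range (4 * N + 1), (hat N i : ℂ) • T ^ i =
      ∑ i ∈ Finset.range (4 * N + 1), ((hat N (i - 1) - hat N i : ℝ) : ℂ) • T ^ i := by
  have h1 : T * ∑ i ∈ Finset.range (4 * N + 1), (hat N i : ℂ) • T ^ i =
      ∑ i ∈ Finset.range (4 * N + 1), (hat N (i - 1) : ℂ) • T ^ i := by
    rw [Finset.sum_range_succ, Finset.sum_range_succ', hat_top, Complex.ofReal_zero, zero_smul,
      add_zero, Nat.zero_sub, hat_zero, Complex.ofReal_zero, zero_smul, add_zero, Finset.mul_sum]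
    refine Finset.sum_congr rfl fun i _ => ?_
    rw [mul_smul_comm, Nat.add_sub_cancel, pow_succ']
  rw [sub_mul, h1, one_mul, ← Finset.sum_sub_distrib]
  refine Finset.sum_congr rfl fun i _ => ?_
  rw [Complex.ofReal_sub, sub_smul]

variable {E : Type*} [NormedAddCommGroup E] [ConditionallyCompleteLattice E]
  [IsOrderedAddMonoid E] [NormedSpace ℝ E] [IsOrderedModule ℝ E] [HasSolidNorm E]
  {S A : Cpx E →L[ℂ] Cpx E}

theorem norm_sum_modulus_le (s : Finset ℕ) (f : ℕ → Cpx E) :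
    ‖∑ i ∈ s, modulus (f i)‖ ≤ ∑ i ∈ s, ‖f i‖ := norm_sum_le _ _

theorem norm_bandProj_le (V : Set (Cpx E)) (x : Cpx E) : ‖bandProj V x‖ ≤ ‖x‖ :=
  norm_le_of_modulus_le (modulus_bandProj_le V x)

/-- The norm of the middle window of a tower over a wandering set. -/
theorem norm_window_le (hS : IsDIsomorphism S) (hA : IsCentral A)
    {Y : Submodule ℂ (Cpx E)} (hY : IsAIM Y) (hTY : ∀ y ∈ Y, (A ∘L S) y ∈ Y) {c : ℝ} (hc : 0 < c)
    (h : ∀ y ∈ Y, c * ‖y‖ ≤ ‖(A ∘L S) y - y‖) {N : ℕ} (hN : 0 < N) {U : Set (Cpx E)}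
    (hU : Wandering S (4 * N) U) (j : ℕ) (x : Cpx E) {κ : ℝ}
    (hκ : ∑ i ∈ Finset.range (4 * N + 1), ‖((A ∘L S) ^ i) x - x‖ ≤ κ) :
    c * ‖∑ i ∈ Finset.Icc N (3 * N), modulus (bandProj ((S ^ (j + i)) '' U) x)‖ ≤
      (N : ℝ)⁻¹ * (‖x‖ + κ) + c * κ := by
  set T := A ∘L S with hT
  set I := Finset.range (4 * N + 1) with hI
  set P : ℕ → Cpx E →L[ℂ] Cpx E := fun i => bandProj ((S ^ (j + i)) '' U) with hP
  set V := (S ^ j) '' U with hV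
  have hVW : Wandering S (4 * N) V := hU.image hS j
  set u := bandProj V x with hu
  -- Level `i` of the tower over `u` is thus `P i x` up to the error `P i (T ^ i x - x)`; these
  -- errors sum to at most `κ` in norm.
  have hTu : ∀ i, (T ^ i) u = P i ((T ^ i) x) := fun i => pow_bandProj_image hS hA U i j x
  have hIle : ∀ i ∈ I, i ≤ 4 * N := fun i hi => by rw [hI, Finset.mem_range] at hi; omega
  have hJI : Finset.Icc N (3 * N) ⊆ I := fun i hi => by
    rw [Finset.mem_Icc] at hi; rw [hI, Finset.mem_range]; omega
  have huV : u ∈ polar (polar V : Set (Cpx E)) := bandProj_mem V x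
  have hdisj : ∀ (a : ℕ → ℂ), ∀ i ∈ I, ∀ i' ∈ I, i ≠ i' →
      Disj ((a i • T ^ i) u) ((a i' • T ^ i') u) := fun a i hi i' hi' hii =>
    ((((hVW.polar_polar hS).disj_pow hS hA huV huV (hIle i hi) (hIle i' hi') hii).smul_left
      _).symm.smul_left _).symm
  have herr : ∀ s ⊆ I, ‖∑ i ∈ s, modulus (P i ((T ^ i) x - x))‖ ≤ κ := fun s hs =>
    (norm_sum_modulus_le s _).trans (((Finset.sum_le_sum fun i _ => norm_bandProj_le _ _).trans
      (Finset.sum_le_sum_of_subset_of_nonneg hs fun i _ _ => norm_nonneg _)).trans hκ)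
  set W₂ : Cpx E →L[ℂ] Cpx E := ∑ i ∈ I, (hat N i : ℂ) • T ^ i with hW₂
  set W₁ : Cpx E →L[ℂ] Cpx E :=
    ∑ i ∈ I, ((hat N (i - 1) - hat N i : ℝ) : ℂ) • T ^ i with hW₁
  have hW : (T - 1) * W₂ = W₁ := sub_one_mul_sum_hat T N
  have hlow : c * ‖W₂ u‖ ≤ ‖W₁ u‖ := by
    refine hY.lower_bound_of_disjointnessPreserving
      (hVW.disjointnessPreserving_sum hS hA hIle _)
      (hVW.disjointnessPreserving_sum hS hA hIle _) hc.le (fun y hy => ?_) huV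
    have h1 : W₂ y ∈ Y := by
      rw [hW₂, sum_apply]
      exact sum_mem fun i _ => Submodule.smul_mem _ _ (pow_mem hTY i hy)
    have h2 := h _ h1
    rwa [show T (W₂ y) - W₂ y = W₁ y from
      congrArg (fun D : Cpx E →L[ℂ] Cpx E => D y) hW] at h2
  have hup : ‖W₁ u‖ ≤ (N : ℝ)⁻¹ * (‖x‖ + κ) := by
    have h1 : modulus (W₁ u) ≤ (N : ℝ)⁻¹ • (modulus x + ∑ i ∈ I, modulus (P i ((T ^ i) x - x))) := by
      rw [hW₁, sum_apply]
      refine (modulus_sum_le _ _).trans ?_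
      -- The levels are disjoint components of `x`, so all `4 * N + 1` of them together cost only
      -- `|x|`. This keeps the factor `1 / N` effective.
      have h2 : ∑ i ∈ I, modulus (P i x) ≤ modulus x := by
        refine Riesz.sum_le_of_pairwise_inf_eq_zero (modulus_nonneg x)
          (fun i _ => modulus_nonneg _) (fun i _ => modulus_bandProj_le _ _) ?_
        have key : ∀ i i', i < i' → i' ≤ 4 * N → Disj (P i x) (P i' x) := by
          intro i i' hii hi'
          have h3 : ∀ v ∈ U, ∀ v' ∈ U, Disj ((S ^ (j + i)) v) ((S ^ (j + i')) v') := by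
            intro v hv v' hv'
            rw [show j + i' = (j + i) + (i' - i) by omega, pow_add_apply S (j + i) (i' - i)]
            exact (hS.pow _).disj_iff.2 (hU v hv v' hv' _ (by omega) (by omega))
          refine bandProj_mem _ x _ ?_
          refine polar_polar_le ?_ (bandProj_mem _ x)
          rintro _ ⟨v', hv', rfl⟩ _ ⟨v, hv, rfl⟩
          exact (h3 v hv v' hv').symm
        intro i hi i' hi' hii
        rcases lt_or_gt_of_ne hii with hlt | hlt
        · exact key i i' hlt (hIle i' hi')
        · exact (key i' i hlt (hIle i hi)).symm
      calc ∑ i ∈ I, modulus ((((hat N (i - 1) - hat N i : ℝ) : ℂ) • T ^ i) u)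
          ≤ ∑ i ∈ I, (N : ℝ)⁻¹ • (modulus (P i x) + modulus (P i ((T ^ i) x - x))) := by
            refine Finset.sum_le_sum fun i _ => ?_
            rw [smul_apply, modulus_smul, hTu, Complex.norm_real, Real.norm_eq_abs]
            have h4 : modulus (P i ((T ^ i) x)) ≤
                modulus (P i x) + modulus (P i ((T ^ i) x - x)) := by
              refine le_of_eq_of_le ?_ (modulus_add_le _ _)
              rw [← map_add, add_sub_cancel]
            exact (smul_le_smul_of_nonneg_right (abs_hat_sub_hat_le N i)
              (modulus_nonneg _)).trans (smul_le_smul_of_nonneg_left h4 (by positivity))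
        _ = (N : ℝ)⁻¹ • (∑ i ∈ I, modulus (P i x) +
              ∑ i ∈ I, modulus (P i ((T ^ i) x - x))) := by
            rw [← Finset.smul_sum, Finset.sum_add_distrib]
        _ ≤ _ := smul_le_smul_of_nonneg_left (add_le_add h2 le_rfl) (by positivity)
    refine (norm_mono (modulus_nonneg _) h1).trans ?_
    rw [norm_smul, Real.norm_of_nonneg (by positivity)]
    gcongr
    exact (norm_add_le _ _).trans (add_le_add le_rfl (herr I subset_rfl))
  have hwin : ‖∑ i ∈ Finset.Icc N (3 * N), modulus (P i x)‖ ≤ ‖W₂ u‖ + κ := by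
    have h1 : ∑ i ∈ Finset.Icc N (3 * N), modulus (P i x) ≤
        modulus (W₂ u) + ∑ i ∈ Finset.Icc N (3 * N), modulus (P i ((T ^ i) x - x)) := by
      have h2 : modulus (W₂ u) = ∑ i ∈ I, hat N i • modulus ((T ^ i) u) := by
        rw [hW₂, sum_apply, modulus_sum (hdisj fun i => (hat N i : ℂ))]
        refine Finset.sum_congr rfl fun i hi => ?_
        rw [smul_apply, modulus_smul, Complex.norm_real,
          Real.norm_of_nonneg (hat_nonneg (hIle i hi))]
      -- The hat is at least `1` on this window, and the summands of `W₂ u` are disjoint.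
      have h3 : ∑ i ∈ Finset.Icc N (3 * N), modulus ((T ^ i) u) ≤ modulus (W₂ u) := by
        rw [h2]
        refine (Finset.sum_le_sum fun i hi => ?_).trans (Finset.sum_le_sum_of_subset_of_nonneg hJI
          fun i hi _ => smul_nonneg (hat_nonneg (hIle i hi)) (modulus_nonneg _))
        rw [Finset.mem_Icc] at hi
        have h4 := smul_le_smul_of_nonneg_right (one_le_hat hN hi.1 hi.2)
          (modulus_nonneg ((T ^ i) u))
        rwa [one_smul] at h4
      refine le_trans ?_ (add_le_add h3 le_rfl)
      rw [← Finset.sum_add_distrib]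
      refine Finset.sum_le_sum fun i _ => ?_
      rw [hTu]
      refine le_of_eq_of_le ?_ (modulus_sub_le _ _)
      rw [← map_sub, sub_sub_cancel]
    exact (norm_mono (Finset.sum_nonneg fun i _ => modulus_nonneg _) h1).trans
      ((norm_add_le _ _).trans (add_le_add le_rfl (herr _ hJI)))
  calc c * ‖∑ i ∈ Finset.Icc N (3 * N), modulus (P i x)‖ ≤ c * (‖W₂ u‖ + κ) := by gcongr
    _ = c * ‖W₂ u‖ + c * κ := mul_add _ _ _
    _ ≤ (N : ℝ)⁻¹ * (‖x‖ + κ) + c * κ := by exact add_le_add (hlow.trans hup) le_rfl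

/-- The lower estimate on the band of vectors without a part of small period. -/
theorem exists_lower_bound_aperiodic (hS : IsDIsomorphism S) (hA : IsCentral A)
    {Y : Submodule ℂ (Cpx E)} (hY : IsAIM Y) (hTY : ∀ y ∈ Y, (A ∘L S) y ∈ Y) {c : ℝ} (hc : 0 < c)
    (h : ∀ y ∈ Y, c * ‖y‖ ≤ ‖(A ∘L S) y - y‖) :
    ∃ (k : ℕ) (C : ℝ), 0 ≤ C ∧ ∀ x ∈ aperiodicBand S k, ‖x‖ ≤ C * ‖(A ∘L S) x - x‖ := by
  set T := A ∘L S with hT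
  -- Four windows contribute `4 / N * ‖x‖`, which is then at most half of `c * ‖x‖` and can be
  -- absorbed.
  obtain ⟨N, hN⟩ := exists_nat_gt (8 / c)
  have hN0 : (0 : ℝ) < N := lt_trans (by positivity) hN
  have hNpos : 0 < N := by exact_mod_cast hN0
  set K : ℝ := ∑ i ∈ Finset.range (4 * N + 1), ‖∑ l ∈ Finset.range i, T ^ l‖ with hK
  have hK0 : 0 ≤ K := Finset.sum_nonneg fun i _ => norm_nonneg _
  obtain ⟨U, hU, hcov⟩ := exists_wandering_cover hS (4 * N) N
  refine ⟨4 * N, 8 * (c⁻¹ * ((N : ℝ)⁻¹ * K + c * K)), by positivity, fun x hx => ?_⟩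
  set κ := K * ‖T x - x‖ with hκ
  have hκ' : ∑ i ∈ Finset.range (4 * N + 1), ‖(T ^ i) x - x‖ ≤ κ := by
    rw [hκ, hK, Finset.sum_mul]
    exact Finset.sum_le_sum fun i _ => norm_pow_sub_le T i x
  have hwin := fun j => norm_window_le hS hA hY hTY hc h hNpos hU j x hκ'
  obtain ⟨z, hzx, hz, hxz⟩ := exists_modulus_le_add_sum
    (Finset.range 4 ×ˢ Finset.Icc N (3 * N))
    (fun p : ℕ × ℕ => (S ^ (2 * N * p.1 + p.2)) '' U) x
  have hz0 : z = 0 := by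
    refine hcov z (mem_aperiodicBand_of_modulus_le hx hzx) fun r hr => ?_
    -- The levels `N, …, 9 * N` of the cover are exhausted by the four windows from `(2 * m + 1) *
    -- N` to `(2 * m + 3) * N`.
    have key : ∀ m i, m < 4 → N ≤ i → i ≤ 3 * N → 2 * N * m + i = N + r →
        z ∈ polar ((S ^ (N + r)) '' U) := by
      intro m i hm hi hi' e
      have h1 := hz (m, i) (Finset.mem_product.2
        ⟨Finset.mem_range.2 hm, Finset.mem_Icc.2 ⟨hi, hi'⟩⟩)
      rwa [e] at h1
    rcases le_total r (2 * N) with h1 | h1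
    · exact key 0 (N + r) (by omega) (by omega) (by omega) (by omega)
    rcases le_total r (4 * N) with h2 | h2
    · exact key 1 (N + r - 2 * N) (by omega) (by omega) (by omega) (by omega)
    rcases le_total r (6 * N) with h3 | h3
    · exact key 2 (N + r - 4 * N) (by omega) (by omega) (by omega) (by omega)
    · exact key 3 (N + r - 6 * N) (by omega) (by omega) (by omega) (by omega)
  rw [hz0, modulus_zero, zero_add, Finset.sum_product] at hxz
  have h1 : ‖x‖ ≤ ∑ m ∈ Finset.range 4,
      ‖∑ i ∈ Finset.Icc N (3 * N), modulus (bandProj ((S ^ (2 * N * m + i)) '' U) x)‖ :=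
    (norm_mono (modulus_nonneg x) hxz).trans (norm_sum_le _ _)
  have h2 : c * ‖x‖ ≤ 4 * ((N : ℝ)⁻¹ * (‖x‖ + κ) + c * κ) := by
    calc c * ‖x‖ ≤ c * ∑ m ∈ Finset.range 4,
          ‖∑ i ∈ Finset.Icc N (3 * N), modulus (bandProj ((S ^ (2 * N * m + i)) '' U) x)‖ := by
          gcongr
      _ ≤ ∑ m ∈ Finset.range 4, ((N : ℝ)⁻¹ * (‖x‖ + κ) + c * κ) := by
          rw [Finset.mul_sum]
          exact Finset.sum_le_sum fun m _ => hwin (2 * N * m)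
      _ = _ := by rw [Finset.sum_const, Finset.card_range, nsmul_eq_mul]; norm_num
  have h3 : 8 * (N : ℝ)⁻¹ ≤ c := by
    rw [← div_eq_mul_inv, div_le_iff₀ hN0]
    rw [div_lt_iff₀ hc] at hN
    linarith
  have h4 : 8 * (N : ℝ)⁻¹ * ‖x‖ ≤ c * ‖x‖ := by gcongr
  have h5 : c * ‖x‖ ≤ 8 * ((N : ℝ)⁻¹ * κ + c * κ) := by linarith
  have h6 : ‖x‖ ≤ c⁻¹ * (8 * ((N : ℝ)⁻¹ * κ + c * κ)) := (le_inv_mul_iff₀ hc).2 h5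
  refine h6.trans_eq ?_
  rw [hκ]
  ring

/-- Descent in `k`: the part of `x` of period `k + 1` is split off and handled by the periodic
estimate, until for `k = 0` no aperiodicity is required. The splitting projection commutes with `T`
because `S` maps the periodic band onto itself. -/
theorem exists_lower_bound_of_one (hS : IsDIsomorphism S) (hA : IsCentral A)
    {Y : Submodule ℂ (Cpx E)} (hY : IsAIM Y) (hTY : ∀ y ∈ Y, (A ∘L S) y ∈ Y) {c : ℝ} (hc : 0 < c)
    (h : ∀ y ∈ Y, c * ‖y‖ ≤ ‖(A ∘L S) y - y‖) :
    ∃ C : ℝ, 0 ≤ C ∧ ∀ x, ‖x‖ ≤ C * ‖(A ∘L S) x - x‖ := by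
  obtain ⟨k, hk⟩ := exists_lower_bound_aperiodic hS hA hY hTY hc h
  induction k with
  | zero =>
    obtain ⟨C, hC, hk⟩ := hk
    exact ⟨C, hC, fun x => hk x fun q h1 h2 => by omega⟩
  | succ k ih =>
    obtain ⟨C, hC, hk⟩ := hk
    obtain ⟨C', hC', hk'⟩ := exists_lower_bound_periodic hS hA hY hTY hc h k
    refine ih ⟨C' + C, by positivity, fun x hx => ?_⟩
    set T := A ∘L S
    set V : Set (Cpx E) := ((periodicBand S (k + 1) : Submodule ℂ (Cpx E)) : Set (Cpx E))
    have hVV : polar (polar V : Set (Cpx E)) ≤ periodicBand S (k + 1) := polar_polar_le subset_rfl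
    have hTP : T (bandProj V x) = bandProj V (T x) := by
      have h1 := comp_bandProj_image hS hA V 0 x
      have h2 : ⇑(S ^ 0) '' V = V := Set.image_id V
      have h3 : ⇑(S ^ (0 + 1)) '' V = V := by
        rw [zero_add, pow_one]; exact image_periodicBand hS (k + 1)
      rwa [h2, h3] at h1
    have hPx : ‖bandProj V x‖ ≤ C' * ‖T x - x‖ := by
      refine (hk' _ (mem_aperiodicBand_of_modulus_le hx (modulus_bandProj_le V x))
        (hVV (bandProj_mem V x))).trans ?_
      rw [hTP, ← map_sub]
      gcongr
      exact norm_bandProj_le V _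
    have hQx : ‖x - bandProj V x‖ ≤ C * ‖T x - x‖ := by
      refine (hk _ fun q hq hqk => ?_).trans ?_
      · rcases Nat.lt_or_ge k q with hkq | hkq
        · obtain rfl : q = k + 1 := by omega
          exact sub_bandProj_mem V x
        · exact mem_polar_of_modulus_le (hx q hq hkq) (modulus_sub_bandProj_le V x)
      · gcongr
        refine norm_le_of_modulus_le (le_of_eq_of_le ?_ (modulus_sub_bandProj_le V (T x - x)))
        rw [map_sub, map_sub, hTP, sub_sub_sub_comm]
    calc ‖x‖ = ‖bandProj V x + (x - bandProj V x)‖ := by rw [add_sub_cancel]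
      _ ≤ C' * ‖T x - x‖ + C * ‖T x - x‖ := (norm_add_le _ _).trans (add_le_add hPx hQx)
      _ = (C' + C) * ‖T x - x‖ := by ring

theorem IsCentral.smul (hA : IsCentral A) (c : ℂ) : IsCentral (c • A) := by
  obtain ⟨r, hr, h⟩ := hA
  refine ⟨‖c‖ * r, by positivity, fun x => ?_⟩
  rw [smul_apply, modulus_smul, mul_smul]
  exact smul_le_smul_of_nonneg_left (h x) (norm_nonneg c)

/-- If `lam - A ∘ S` is bounded from below on an invariant AIM subspace, it is bounded from below
on the whole space. -/
theorem exists_lower_bound (hS : IsDIsomorphism S) (hA : IsCentral A)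
    {Y : Submodule ℂ (Cpx E)} (hY : IsAIM Y) (hTY : ∀ y ∈ Y, (A ∘L S) y ∈ Y) (lam : ℂ) {c : ℝ}
    (hc : 0 < c) (h : ∀ y ∈ Y, c * ‖y‖ ≤ ‖lam • y - (A ∘L S) y‖) :
    ∃ c' : ℝ, 0 < c' ∧ ∀ x, c' * ‖x‖ ≤ ‖lam • x - (A ∘L S) x‖ := by
  rcases eq_or_ne lam 0 with rfl | hlam
  · refine ⟨c, hc, fun x => ?_⟩
    have hT := hS.disjointnessPreserving_comp hA
    have h1 := hY.lower_bound_of_disjointnessPreserving (W₁ := A ∘L S) (W₂ := 1) (V := {x})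
      (hT.comp (disjointnessPreserving_bandProj _))
      (disjointnessPreserving_one.comp (disjointnessPreserving_bandProj _)) hc.le
      (fun y hy => by simpa using h y hy) (subset_polar_polar rfl)
    simpa using h1
  · have hn : 0 < ‖lam‖ := norm_pos_iff.2 hlam
    have key : ∀ x, ‖((lam⁻¹ • A) ∘L S) x - x‖ = ‖lam‖⁻¹ * ‖lam • x - (A ∘L S) x‖ := fun x => by
      rw [← norm_inv, ← norm_smul, smul_sub, inv_smul_smul₀ hlam, norm_sub_rev]
      rfl
    obtain ⟨C, hC, h1⟩ := exists_lower_bound_of_one hS (hA.smul lam⁻¹) hY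
      (fun y hy => Submodule.smul_mem Y lam⁻¹ (hTY y hy))
      (c := ‖lam‖⁻¹ * c) (by positivity) (fun y hy => by
        rw [key, mul_assoc]
        exact mul_le_mul_of_nonneg_left (h y hy) (by positivity))
    -- `C + 1` replaces `C`, which may vanish, to keep the constant positive.
    refine ⟨((C + 1) * ‖lam‖⁻¹)⁻¹, by positivity, fun x => ?_⟩
    rw [inv_mul_le_iff₀ (by positivity), mul_assoc, ← key]
    refine (h1 x).trans (mul_le_mul_of_nonneg_right (by linarith) (norm_nonneg _))

end Cpx

/-- Failure of a lower bound already puts `lam` in the spectrum, because a bounded inverse would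
provide one. -/
theorem mem_approxPointSpectrum_iff {V : Type*} [NormedAddCommGroup V] [NormedSpace ℂ V]
    {T : V →L[ℂ] V} {lam : ℂ} : lam ∈ approxPointSpectrum T ↔
      ¬ ∃ c : ℝ, 0 < c ∧ ∀ x : V, c * ‖x‖ ≤ ‖lam • x - T x‖ := by
  refine ⟨fun h hc => h.2 ⟨h.1, hc⟩, fun h => ⟨fun hr => h ?_, fun hr => h hr.2⟩⟩
  obtain ⟨u, hu⟩ := hr
  have hu' : ∀ x, lam • x - T x = (u : V →L[ℂ] V) x := fun x => by
    rw [hu, Algebra.algebraMap_eq_smul_one]; rfl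
  set R : V →L[ℂ] V := (↑u⁻¹ : V →L[ℂ] V)
  refine ⟨(‖R‖ + 1)⁻¹, by positivity, fun x => ?_⟩
  rw [inv_mul_le_iff₀ (by positivity), hu']
  have h1 : R ((u : V →L[ℂ] V) x) = x :=
    congrArg (fun D : V →L[ℂ] V => D x) (Units.inv_mul u)
  calc ‖x‖ = ‖R ((u : V →L[ℂ] V) x)‖ := by rw [h1]
    _ ≤ ‖R‖ * ‖(u : V →L[ℂ] V) x‖ := R.le_opNorm _
    _ ≤ (‖R‖ + 1) * ‖(u : V →L[ℂ] V) x‖ := by gcongr; linarith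

/-- `Cpx E`, for a Dedekind complete real Banach lattice `E`, is the general Dedekind complete
complex Banach lattice `X`. -/
theorem theorem1 {E : Type*} [NormedAddCommGroup E] [ConditionallyCompleteLattice E]
    [IsOrderedAddMonoid E] [HasSolidNorm E] [NormedSpace ℝ E] [IsOrderedModule ℝ E]
    [CompleteSpace E]
    (S A T : Cpx E →L[ℂ] Cpx E) (hS : Cpx.IsDIsomorphism S) (hA : Cpx.IsCentral A)
    (hT : T = A ∘L S)
    (Y : Submodule ℂ (Cpx E)) (hY : Cpx.IsAIM Y) (hTY : ∀ y ∈ Y, T y ∈ Y) :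
    approxPointSpectrum T = approxPointSpectrum (T.restrict hTY) := by
  subst hT
  ext lam
  rw [mem_approxPointSpectrum_iff, mem_approxPointSpectrum_iff, not_iff_not]
  constructor
  · rintro ⟨c, hc, h⟩
    exact ⟨c, hc, fun y => h y⟩
  · rintro ⟨c, hc, h⟩
    exact Cpx.exists_lower_bound hS hA hY hTY lam hc fun y hy => h ⟨y, hy⟩
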